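/- Let $S=(S(t))_{t\ge 0}$ be a subordinator without drift whose Lévy measure $\sigma$ satisfies $\int_{(0,\infty)}(1\wedge\tau)\,d\sigma(\tau)<\infty$ and $\sigma(0,\infty)=\infty$, so that $\mathbf E[e^{-\lambda S(t)}]=e^{-t\Phi(\lambda)}$ with $\Phi(\lambda)=\int_{(0,\infty)}(1-e^{-\lambda\tau})\,d\sigma(\tau)$ for $\lambda\ge 0$. Put $k(t)=\sigma((t,\infty))$ and $\mathcal K(\lambda)=\int_0^\infty e^{-\lambda t}k(t)\,dt$. Let $E(t)=\inf\{s\ge 0: S(s)\ge t\}$ be the inverse process and $G_t(\tau)$ the density of $E(t)$. On $\mathbb R^d$, $d\ge1$, let $v(x,t)=(2\pi t)^{-d/2}e^{-|x|^2/(2t)}$ be the heat kernel of $\partial_t u=\tfrac12\Delta u$, and define $$v^E(x,t)=\int_0^\infty v(x,\tau)\,G_t(\tau)\,d\tau,\qquad M_t\big(v^E(x,t)\big)=\frac1t\int_0^t v^E(x,s)\,ds .$$ Assume that, for some real constant $\mu(0)\ne 0$ (which is then necessarily positive), $$\mathcal K(\lambda)\sim \lambda^{-1}\,\frac{\mu(0)}{\log(1/\lambda)}\qquad\text{as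 }\lambda\to 0^+ .$$ Let $x\in\mathbb R^d$, with $x\neq 0$ if $d\ge 2$. Then, for almost every $t>0$, $E(t)$ has a density and the integral defining $v^E(x,t)$ converges; $v^E(x,\cdot)$ is integrable on every interval $(0,t]$; and there is a constant $C\ne 0$, depending only on $d$ and $\mu(0)$, such that, as $t\to\infty$ (where $f\sim g$ means that $f/g\to1$): 1. if $d=1$, $\;M_t\big(v^E(x,t)\big)\sim C\log(t)^{-1/2}\exp\!\big(-\sqrt{2\mu(0)}\,|x|\log(t)^{-1/2}\big)$; 2. if $d=2$, $\;M_t\big(v^E(x,t)\big)\sim C\log(t)^{-1}\ln\!\big(\sqrt{2\mu(0)}\,|x|\log(t)^{-1/2}\big)$ (the logarithm being negative for large $t$, so that $C<0$); 3. if $d\ge 3$, $\;M_t\big(v^E(x,t)\big)\sim C|x|^{2-d}\log(t)^{-1}$. -/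

import Mathlib

open MeasureTheory ProbabilityTheory Filter Asymptotics Topology
open scoped NNReal ENNReal

noncomputable section

namespace SubordinatedHeat

/-- A subordinator: a real process issued from `0`, with independent and stationary increments,
whose paths are almost surely nondecreasing and right-continuous. (Left limits exist
automatically for nondecreasing paths.) -/
structure IsSubordinator {Ω : Type*} [MeasurableSpace Ω] (S : ℝ≥0 → Ω → ℝ) (P : Measure Ω) :
    Prop where
  measurable : ∀ t, Measurable (S t)
  zero : ∀ᵐ ω ∂P, S 0 ω = 0
  indepIncrements : HasIndepIncrements S P
  stationaryIncrements : ∀ s t : ℝ≥0,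
    IdentDistrib (fun ω => S (s + t) ω - S s ω) (S t) P P
  monotone : ∀ᵐ ω ∂P, Monotone fun t => S t ω
  rightContinuous : ∀ᵐ ω ∂P, ∀ t, ContinuousWithinAt (fun s => S s ω) (Set.Ici t) t

/-- The driftless Laplace exponent `Φ(z) = ∫_{(0,∞)} (1 - e^{-z τ}) dσ(τ)` of a measure `σ`. -/
def laplaceExponent (σ : Measure ℝ) (z : ℝ) : ℝ :=
  ∫ τ in Set.Ioi (0 : ℝ), (1 - Real.exp (-z * τ)) ∂σ

/-- `σ` (of which only the part on `(0,∞)` matters) satisfies the integrability condition of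
Lévy measures of subordinators and has infinite mass, and `S` is the subordinator without drift
with Lévy measure `σ`: `E[e^{-z S(t)}] = e^{-t Φ(z)}`. -/
structure HasLevyMeasure {Ω : Type*} [MeasurableSpace Ω] (S : ℝ≥0 → Ω → ℝ) (P : Measure Ω)
    (σ : Measure ℝ) : Prop where
  lintegral_min_lt_top : ∫⁻ τ in Set.Ioi (0 : ℝ), ENNReal.ofReal (min 1 τ) ∂σ < ∞
  infinite_mass : σ (Set.Ioi 0) = ∞
  laplace : ∀ (t : ℝ≥0) (z : ℝ), 0 ≤ z →
    ∫ ω, Real.exp (-z * S t ω) ∂P = Real.exp (-t * laplaceExponent σ z)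

/-- The kernel `k(t) = σ((t,∞))`, for `t > 0`. -/
def levyTail (σ : Measure ℝ) (t : ℝ) : ℝ := (σ (Set.Ioi t)).toReal

/-- The Laplace transform `𝒦(z) = ∫_0^∞ e^{-z t} k(t) dt`. -/
def levyTailLaplace (σ : Measure ℝ) (z : ℝ) : ℝ :=
  ∫ t in Set.Ioi (0 : ℝ), Real.exp (-z * t) * levyTail σ t

/-- The inverse process `E(t) = inf {s ≥ 0 : S(s) ≥ t}`. -/
def inverseProcess {Ω : Type*} (S : ℝ≥0 → Ω → ℝ) (t : ℝ) (ω : Ω) : ℝ :=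
  ((sInf {s : ℝ≥0 | t ≤ S s ω} : ℝ≥0) : ℝ)

/-- The marginal density `G_t(τ)` of `E(t)` with respect to Lebesgue measure. -/
def inverseDensity {Ω : Type*} [MeasurableSpace Ω] (S : ℝ≥0 → Ω → ℝ) (P : Measure Ω)
    (t τ : ℝ) : ℝ :=
  (pdf (inverseProcess S t) P volume τ).toReal

/-- The heat kernel `v(x,t) = (2πt)^{-d/2} e^{-|x|²/(2t)}` of `∂_t u = ½ Δu` on `ℝ^d`. -/
def heatKernel {d : ℕ} (x : EuclideanSpace ℝ (Fin d)) (t : ℝ) : ℝ :=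
  (2 * Real.pi * t) ^ (-(d : ℝ) / 2) * Real.exp (-‖x‖ ^ 2 / (2 * t))

/-- The subordinated heat kernel `v^E(x,t) = ∫_0^∞ v(x,τ) G_t(τ) dτ`. -/
def subordinatedKernel {Ω : Type*} [MeasurableSpace Ω] (S : ℝ≥0 → Ω → ℝ) (P : Measure Ω)
    {d : ℕ} (x : EuclideanSpace ℝ (Fin d)) (t : ℝ) : ℝ :=
  ∫ τ in Set.Ioi (0 : ℝ), heatKernel x τ * inverseDensity S P t τ

/-- The Cesàro mean `M_t(f) = (1/t) ∫_0^t f(s) ds`. -/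
def cesaroMean (f : ℝ → ℝ) (t : ℝ) : ℝ := (1 / t) * ∫ s in (0 : ℝ)..t, f s

/-- All the integrals behind the Cesàro means of `v^E(x,·)` make sense: for almost every `s > 0`
the variable `E(s)` has a density and the integral defining `v^E(x,s)` converges absolutely, and
`v^E(x,·)` is integrable on every interval `(0,t]`. -/
def CesaroMeanWellDefined {Ω : Type*} [MeasurableSpace Ω] (S : ℝ≥0 → Ω → ℝ) (P : Measure Ω)
    {d : ℕ} (x : EuclideanSpace ℝ (Fin d)) : Prop :=
  (∀ᵐ s ∂(volume.restrict (Set.Ioi (0 : ℝ))),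
      HasPDF (inverseProcess S s) P volume ∧
      IntegrableOn (fun τ => heatKernel x τ * inverseDensity S P s τ) (Set.Ioi 0)) ∧
    ∀ t : ℝ, 0 < t → IntegrableOn (subordinatedKernel S P x) (Set.Ioc 0 t)

end SubordinatedHeat

end

/-!
The heat kernel is integrated against the law of the inverse `E(t)` of a subordinator with Laplace
exponent `Φ`. The whole argument takes place on the side of the Laplace transform in `t`.

*The density of `E(t)`.* By monotonicity and right continuity of the paths, `{E(t) > s}` and
`{S(s) < t}` agree almost surely, so that `∫ e^{-zt} P(E(t) > s) dt = e^{-sΦ(z)} / z`. The function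
`g(t, τ) = E[σ((t - S(τ), ∞)); S(τ) < t]` has the Laplace transform `z⁻¹ Φ(z) e^{-τΦ(z)}`
(`IsSubordinator.laplace_inverseDensityVersion`), whose integral over `τ > s` is the same
expression. Uniqueness of the Laplace transform (`ae_eq_of_laplace_eq`) shows that for almost
every `t` the law of `E(t)` agrees with `g(t, τ) dτ` on all rational half-lines, hence has density
`g(t, ·)` (`IsSubordinator.ae_map_inverseProcess`). Only the one-dimensional laws of `S` enter.

*The transform of `v^E`.* By Tonelli, `∫ e^{-zt} v^E(x,t) dt = z⁻¹ Φ(z) R(Φ(z))`, where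
`R(p) = ∫ e^{-pτ} v(x,τ) dτ` is the resolvent kernel
(`IsSubordinator.laplace_subordinatedKernel`). Finiteness of this expression contains all the
integrability claims.

*Asymptotics.* Since `𝒦(z) = Φ(z) / z`, the hypothesis says that `Φ(z) log(1/z) → μ₀`; in
particular `μ₀ > 0` and `Φ(z) → 0`. As `p → 0` the resolvent `R(p)` is equivalent to `c p^{-1/2}`
if `d = 1` (`tendsto_sqrt_mul_resolvent_one`), to `(2π)⁻¹ log(1/p)` if `d = 2`
(`tendsto_resolvent_two_div_log`), and converges to the Newtonian kernel `c |x|^{2-d}` if `d ≥ 3`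
(`tendsto_resolvent_of_three_le`). Hence `Φ R(Φ)` is equivalent to an explicit function of
`log(1/z)`, which is slowly varying, and Karamata's Tauberian theorem (`karamata`) turns this into
the behaviour of the Cesàro mean. In dimension one the exponential factor of the statement tends
to `1`, and in dimension two its logarithm is equivalent to `-(1/2) log (log t)`.
-/

namespace SubordinatedHeat

open Set

/-! ### Moments, the Laplace transform and Karamata's Tauberian theorem -/

/-- For measures on `[0,1]`, convergence of the moments implies weak convergence: polynomials are
uniformly dense by the Weierstrass theorem. -/
theorem tendsto_integral_of_tendsto_moments {ι : Type*} {l : Filter ι} {μ : ι → Measure ℝ}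
    {ν : Measure ℝ} [IsFiniteMeasure ν]
    (hμ : ∀ᶠ i in l, IsFiniteMeasure (μ i) ∧ ∀ᵐ y ∂μ i, y ∈ Icc (0 : ℝ) 1)
    (hν : ∀ᵐ y ∂ν, y ∈ Icc (0 : ℝ) 1)
    (h : ∀ n : ℕ, Tendsto (fun i => ∫ y, y ^ n ∂μ i) l (𝓝 (∫ y, y ^ n ∂ν)))
    {φ : ℝ → ℝ} (hφ : Continuous φ) :
    Tendsto (fun i => ∫ y, φ y ∂μ i) l (𝓝 (∫ y, φ y ∂ν)) := by
  have int_cont : ∀ (m : Measure ℝ) [IsFiniteMeasure m], (∀ᵐ y ∂m, y ∈ Icc (0 : ℝ) 1) →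
      ∀ ψ : ℝ → ℝ, Continuous ψ → Integrable ψ m := by
    intro m _ hm ψ hψ
    obtain ⟨B, hB⟩ := isCompact_Icc.exists_bound_of_continuousOn (s := Icc (0 : ℝ) 1)
      hψ.continuousOn
    exact Integrable.of_bound hψ.aestronglyMeasurable B (hm.mono hB)
  have poly_int : ∀ (m : Measure ℝ) [IsFiniteMeasure m], (∀ᵐ y ∂m, y ∈ Icc (0 : ℝ) 1) →
      ∀ p : Polynomial ℝ, ∫ y, p.eval y ∂m
        = ∑ n ∈ Finset.range (p.natDegree + 1), p.coeff n * ∫ y, y ^ n ∂m := by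
    intro m _ hm p
    simp_rw [Polynomial.eval_eq_sum_range]
    rw [integral_finsetSum]
    · simp_rw [integral_const_mul]
    · intro n _
      exact int_cont m hm _ (by fun_prop)
  have poly_close : ∀ (m : Measure ℝ) [IsFiniteMeasure m], (∀ᵐ y ∂m, y ∈ Icc (0 : ℝ) 1) →
      ∀ (p : Polynomial ℝ) (δ : ℝ), (∀ y ∈ Icc (0 : ℝ) 1, |p.eval y - φ y| < δ) →
        |∫ y, p.eval y ∂m - ∫ y, φ y ∂m| ≤ δ * m.real univ := by
    intro m _ hm p δ hp
    rw [← integral_sub (int_cont m hm _ p.continuous) (int_cont m hm _ hφ)]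
    exact norm_integral_le_of_norm_le_const (f := fun y => p.eval y - φ y)
      (hm.mono fun y hy => (hp y hy).le)
  have hmass : Tendsto (fun i => (μ i).real univ) l (𝓝 (ν.real univ)) := by
    simpa using h 0
  rw [Metric.tendsto_nhds]
  intro ε hε
  set M := ν.real univ with hM
  have hM0 : 0 ≤ M := measureReal_nonneg
  obtain ⟨p, hp⟩ := exists_polynomial_near_of_continuousOn 0 1 φ hφ.continuousOn
    (ε / (3 * (M + 1))) (by positivity)
  have hpoly : Tendsto (fun i => ∑ n ∈ Finset.range (p.natDegree + 1),
      p.coeff n * ∫ y, y ^ n ∂μ i) l (𝓝 (∫ y, p.eval y ∂ν)) := by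
    rw [poly_int ν hν p]
    exact tendsto_finsetSum _ fun n _ => (h n).const_mul _
  filter_upwards [hμ, Metric.tendsto_nhds.1 hpoly (ε / 3) (by positivity),
    hmass.eventually_lt_const (lt_add_one M)] with i hi hpi hmi
  have := hi.1
  have e1 := poly_close (μ i) hi.2 p _ hp
  have e2 := poly_close ν hν p _ hp
  rw [← poly_int (μ i) hi.2 p, Real.dist_eq] at hpi
  rw [Real.dist_eq]
  have hδ : ε / (3 * (M + 1)) * (M + 1) = ε / 3 := by field_simp
  have hδ0 : 0 < ε / (3 * (M + 1)) := by positivity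
  have e1' : ε / (3 * (M + 1)) * (μ i).real univ ≤ ε / 3 := by
    rw [← hδ]; gcongr
  have e2' : ε / (3 * (M + 1)) * ν.real univ < ε / 3 := by
    rw [← hδ]; gcongr; linarith
  rw [abs_le] at e1 e2
  rw [abs_lt] at hpi ⊢
  constructor <;> linarith [e1.1, e1.2, e2.1, e2.2, hpi.1, hpi.2]

/-- A finite measure on `[0,1]` is determined by its moments. -/
theorem ext_of_moments {μ ν : Measure ℝ} [IsFiniteMeasure μ] [IsFiniteMeasure ν]
    (hμ : ∀ᵐ y ∂μ, y ∈ Icc (0 : ℝ) 1) (hν : ∀ᵐ y ∂ν, y ∈ Icc (0 : ℝ) 1)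
    (h : ∀ n : ℕ, ∫ y, y ^ n ∂μ = ∫ y, y ^ n ∂ν) : μ = ν := by
  refine ext_of_forall_integral_eq_of_IsFiniteMeasure fun φ => ?_
  have := tendsto_integral_of_tendsto_moments (ι := ℕ) (l := atTop) (μ := fun _ => μ)
    (Eventually.of_forall fun _ => ⟨inferInstance, hμ⟩) hν
    (fun n => by rw [h n]; exact tendsto_const_nhds) φ.continuous
  exact tendsto_nhds_unique tendsto_const_nhds this

/-- Uniqueness of the Laplace transform, for nonnegative functions. The substitution
`y = e^{-t}` turns the values at the positive integers into the moments of a measure on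
`[0,1]`. -/
theorem ae_eq_of_laplace_eq {a b : ℝ → ℝ≥0∞} (ha : Measurable a) (hb : Measurable b)
    (hab : ∀ z : ℝ, 0 < z → ∫⁻ t in Ioi (0 : ℝ), ENNReal.ofReal (Real.exp (-z * t)) * a t
      = ∫⁻ t in Ioi (0 : ℝ), ENNReal.ofReal (Real.exp (-z * t)) * b t)
    (hfin : ∀ z : ℝ, 0 < z →
      ∫⁻ t in Ioi (0 : ℝ), ENNReal.ofReal (Real.exp (-z * t)) * a t ≠ ∞) :
    a =ᵐ[volume.restrict (Ioi 0)] b := by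
  have hw : Measurable fun t : ℝ => ENNReal.ofReal (Real.exp (-1 * t)) := by fun_prop
  have hE : Measurable fun t : ℝ => Real.exp (-t) := by fun_prop
  have hL : Measurable fun y : ℝ => -Real.log y := by fun_prop
  let m : (ℝ → ℝ≥0∞) → Measure ℝ := fun c =>
    (volume.restrict (Ioi (0 : ℝ))).withDensity fun t => ENNReal.ofReal (Real.exp (-1 * t)) * c t
  have hmfin : ∀ c : ℝ → ℝ≥0∞,
      ∫⁻ t in Ioi (0 : ℝ), ENNReal.ofReal (Real.exp (-1 * t)) * c t ≠ ∞ →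
      IsFiniteMeasure (m c) := fun c hc => isFiniteMeasure_withDensity hc
  have : IsFiniteMeasure (m a) := hmfin a (hfin 1 one_pos)
  have : IsFiniteMeasure (m b) := hmfin b (hab 1 one_pos ▸ hfin 1 one_pos)
  have supp : ∀ c, ∀ᵐ y ∂((m c).map fun t : ℝ => Real.exp (-t)), y ∈ Icc (0 : ℝ) 1 := by
    intro c
    refine (ae_map_iff (p := fun y => y ∈ Icc (0 : ℝ) 1) hE.aemeasurable measurableSet_Icc).2 ?_
    have h1 : ∀ᵐ t ∂(volume.restrict (Ioi (0 : ℝ))), t ∈ Ioi (0 : ℝ) :=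
      ae_restrict_mem measurableSet_Ioi
    have h2 := (withDensity_absolutelyContinuous (volume.restrict (Ioi (0 : ℝ)))
      fun t => ENNReal.ofReal (Real.exp (-1 * t)) * c t).ae_le h1
    filter_upwards [h2] with t ht
    exact ⟨(Real.exp_pos _).le, Real.exp_le_one_iff.2 (by simpa using (mem_Ioi.1 ht).le)⟩
  have mom : ∀ c : ℝ → ℝ≥0∞, Measurable c → ∀ n : ℕ,
      ∫ y, y ^ n ∂((m c).map fun t : ℝ => Real.exp (-t))
        = (∫⁻ t in Ioi (0 : ℝ),
            ENNReal.ofReal (Real.exp (-((n : ℝ) + 1) * t)) * c t).toReal := by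
    intro c hc n
    rw [integral_map hE.aemeasurable (by fun_prop), integral_eq_lintegral_of_nonneg_ae
      (Eventually.of_forall fun t => by positivity) (by fun_prop),
      show m c = (volume.restrict (Ioi (0 : ℝ))).withDensity
        ((fun t => ENNReal.ofReal (Real.exp (-1 * t))) * c) from rfl,
      lintegral_withDensity_eq_lintegral_mul _ (hw.mul hc)
        (g := fun t : ℝ => ENNReal.ofReal (Real.exp (-t) ^ n)) (by fun_prop)]
    congr 1
    refine lintegral_congr fun t => ?_
    simp only [Pi.mul_apply]
    rw [mul_right_comm, ← ENNReal.ofReal_mul (Real.exp_pos _).le, ← Real.exp_nat_mul,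
      ← Real.exp_add]
    congr 3
    ring
  have key : (m a).map (fun t : ℝ => Real.exp (-t)) = (m b).map fun t : ℝ => Real.exp (-t) := by
    refine ext_of_moments (supp a) (supp b) fun n => ?_
    rw [mom a ha, mom b hb, hab _ (by positivity)]
  have key2 : m a = m b := by
    have h := congrArg (Measure.map fun y : ℝ => -Real.log y) key
    simpa [Measure.map_map hL hE, Function.comp_def] using h
  have h3 := (withDensity_eq_iff (hw.mul ha).aemeasurable (hw.mul hb).aemeasurable
    (hfin 1 one_pos)).1 key2
  filter_upwards [h3] with t ht
  have h0 : ENNReal.ofReal (Real.exp (-1 * t)) ≠ 0 := by simp [Real.exp_pos]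
  exact (ENNReal.mul_right_inj h0 ENNReal.ofReal_ne_top).1 ht

/-- The continuous function that is `0` up to `a` and equal to `1 / y` from `b` on. It replaces
the discontinuous cut-off of `1 / y` in the proof of Karamata's theorem. -/
noncomputable def cutInv (a b y : ℝ) : ℝ := (max y a)⁻¹ * max 0 (min 1 ((y - a) / (b - a)))

theorem continuous_cutInv {a b : ℝ} (ha : 0 < a) : Continuous (cutInv a b) := by
  unfold cutInv
  refine Continuous.mul (Continuous.inv₀ (by fun_prop) fun y => ?_) (by fun_prop)
  exact (lt_max_of_lt_right ha).ne'

theorem cutInv_nonneg {a b y : ℝ} (ha : 0 < a) : 0 ≤ cutInv a b y :=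
  mul_nonneg (inv_nonneg.2 (ha.le.trans (le_max_right _ _))) (le_max_left _ _)

theorem cutInv_of_le {a b y : ℝ} (hab : a < b) (hy : y ≤ a) : cutInv a b y = 0 := by
  have : (y - a) / (b - a) ≤ 0 := div_nonpos_of_nonpos_of_nonneg (by linarith) (by linarith)
  rw [cutInv, max_eq_left ((min_le_right _ _).trans this), mul_zero]

theorem cutInv_of_ge {a b y : ℝ} (hab : a < b) (hy : b ≤ y) : cutInv a b y = y⁻¹ := by
  have : 1 ≤ (y - a) / (b - a) := by
    rw [le_div_iff₀ (by linarith)]; linarith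
  rw [cutInv, min_eq_left this, max_eq_right zero_le_one, mul_one, max_eq_left (by linarith)]

theorem cutInv_le_inv {a b y : ℝ} (hy : 0 < y) : cutInv a b y ≤ y⁻¹ := by
  have h1 : max 0 (min 1 ((y - a) / (b - a))) ≤ 1 := max_le zero_le_one (min_le_left _ _)
  have h2 : (max y a)⁻¹ ≤ y⁻¹ := by gcongr; exact le_max_left _ _
  calc cutInv a b y ≤ (max y a)⁻¹ * 1 := by
        unfold cutInv; gcongr
    _ ≤ y⁻¹ := by simpa using h2

theorem integrableOn_cutInv {a b : ℝ} (ha : 0 < a) (c d : ℝ) :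
    IntegrableOn (cutInv a b) (Ioc c d) :=
  ((continuous_cutInv ha).integrableOn_Icc (a := c) (b := d)).mono_set Ioc_subset_Icc_self

theorem setIntegral_cutInv_le {a b : ℝ} (ha : 0 < a) (hab : a < b) (ha1 : a ≤ 1) :
    ∫ y in Ioc (0 : ℝ) 1, cutInv a b y ≤ -Real.log a := by
  have hsplit : Ioc (0 : ℝ) 1 = Ioc 0 a ∪ Ioc a 1 :=
    (Ioc_union_Ioc_eq_Ioc ha.le ha1).symm
  rw [hsplit, setIntegral_union (Ioc_disjoint_Ioc_of_le le_rfl) measurableSet_Ioc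
    (integrableOn_cutInv ha _ _) (integrableOn_cutInv ha _ _),
    setIntegral_congr_fun (g := fun _ => (0 : ℝ)) measurableSet_Ioc
      (fun y hy => cutInv_of_le hab hy.2)]
  have hinv : IntegrableOn (fun y : ℝ => y⁻¹) (Ioc a 1) := by
    rw [← intervalIntegrable_iff_integrableOn_Ioc_of_le ha1]
    exact intervalIntegral.intervalIntegrable_inv (fun y hy => by
      rw [uIcc_of_le ha1] at hy; exact (ha.trans_le hy.1).ne') continuousOn_id
  have : ∫ y in Ioc a 1, cutInv a b y ≤ ∫ y in Ioc a 1, y⁻¹ :=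
    setIntegral_mono_on (integrableOn_cutInv ha _ _) hinv measurableSet_Ioc
      fun y hy => cutInv_le_inv (ha.trans hy.1)
  rw [← intervalIntegral.integral_of_le ha1 (f := fun y : ℝ => y⁻¹),
    integral_inv_of_pos ha one_pos] at this
  simpa [Real.log_inv] using this

theorem le_setIntegral_cutInv {a b : ℝ} (ha : 0 < a) (hab : a < b) (hb1 : b ≤ 1) :
    -Real.log b ≤ ∫ y in Ioc (0 : ℝ) 1, cutInv a b y := by
  have hb : 0 < b := ha.trans hab
  have h1 : ∫ y in Ioc b 1, cutInv a b y ≤ ∫ y in Ioc (0 : ℝ) 1, cutInv a b y :=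
    setIntegral_mono_set (integrableOn_cutInv ha _ _)
      (Eventually.of_forall fun y => cutInv_nonneg ha)
      (Ioc_subset_Ioc_left hb.le).eventuallyLE
  rw [setIntegral_congr_fun (g := fun y : ℝ => y⁻¹) measurableSet_Ioc
    (fun y hy => cutInv_of_ge hab hy.1.le), ← intervalIntegral.integral_of_le hb1,
    integral_inv_of_pos hb one_pos] at h1
  simpa [Real.log_inv] using h1

/-- Karamata's Tauberian theorem of index `1`: if the Laplace transform of a measure on `[0,∞)`
is equivalent to `ℓ(z) / z` at `0`, with `ℓ` slowly varying, then the mass of `[0, 1/z]` is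
equivalent to `ℓ(z) / z`. Slow variation is used along integer dilations only. -/
theorem karamata {U : Measure ℝ} (hU : ∀ᵐ t ∂U, 0 ≤ t)
    (hint : ∀ z : ℝ, 0 < z → Integrable (fun t => Real.exp (-z * t)) U) {ℓ : ℝ → ℝ}
    (hpos : ∀ᶠ z in 𝓝[>] (0 : ℝ), 0 < ℓ z)
    (hslow : ∀ n : ℕ, Tendsto (fun z => ℓ (((n : ℝ) + 1) * z) / ℓ z) (𝓝[>] 0) (𝓝 1))
    (hlap : Tendsto (fun z => z * (∫ t, Real.exp (-z * t) ∂U) / ℓ z) (𝓝[>] 0) (𝓝 1)) :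
    Tendsto (fun z => z * U.real (Iic z⁻¹) / ℓ z) (𝓝[>] 0) (𝓝 1) := by
  -- The images under `t ↦ e^{-zt}` of the measures `(z / ℓ(z)) e^{-zt} dU(t)`: their moments
  -- converge to those of the Lebesgue measure of `[0,1]`.
  let μ : ℝ → Measure ℝ := fun z => ENNReal.ofReal (z / ℓ z) •
    (U.withDensity fun t => ENNReal.ofReal (Real.exp (-z * t))).map fun t => Real.exp (-z * t)
  have hE : ∀ z : ℝ, Measurable fun t : ℝ => Real.exp (-z * t) := fun z => by fun_prop
  have hz : ∀ᶠ z in 𝓝[>] (0 : ℝ), 0 < z := eventually_mem_nhdsWithin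
  have int_eq : ∀ z : ℝ, 0 < z → 0 < ℓ z → ∀ φ : ℝ → ℝ, Continuous φ →
      ∫ y, φ y ∂μ z
        = z / ℓ z * ∫ t, Real.exp (-z * t) * φ (Real.exp (-z * t)) ∂U := by
    intro z hz hl φ hφ
    rw [integral_smul_measure, integral_map (hE z).aemeasurable hφ.aestronglyMeasurable,
      integral_withDensity_eq_integral_toReal_smul (hE z).ennreal_ofReal (by simp),
      ENNReal.toReal_ofReal (by positivity), smul_eq_mul]
    congr 1
    refine integral_congr_ae (Eventually.of_forall fun t => ?_)
    simp [ENNReal.toReal_ofReal (Real.exp_pos _).le]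
  have hμ : ∀ᶠ z in 𝓝[>] (0 : ℝ), IsFiniteMeasure (μ z) ∧ ∀ᵐ y ∂μ z, y ∈ Icc (0 : ℝ) 1 := by
    filter_upwards [hz] with z hz
    have : IsFiniteMeasure (U.withDensity fun t => ENNReal.ofReal (Real.exp (-z * t))) :=
      isFiniteMeasure_withDensity_ofReal (hint z hz).2
    refine ⟨?_, ?_⟩
    · exact Measure.smul_finite _ ENNReal.ofReal_ne_top
    · refine Measure.ae_smul_measure ?_ _
      refine (ae_map_iff (p := fun y => y ∈ Icc (0 : ℝ) 1) (hE z).aemeasurable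
        measurableSet_Icc).2 ?_
      filter_upwards [(withDensity_absolutelyContinuous U
        fun t => ENNReal.ofReal (Real.exp (-z * t))).ae_le hU] with t ht
      refine ⟨(Real.exp_pos _).le, Real.exp_le_one_iff.2 ?_⟩
      nlinarith
  have hν : ∀ᵐ y ∂(volume.restrict (Ioc (0 : ℝ) 1)), y ∈ Icc (0 : ℝ) 1 :=
    (ae_restrict_mem measurableSet_Ioc).mono fun y hy => Ioc_subset_Icc_self hy
  have hmom : ∀ n : ℕ, Tendsto (fun z => ∫ y, y ^ n ∂μ z) (𝓝[>] 0)
      (𝓝 (∫ y in Ioc (0 : ℝ) 1, y ^ n)) := by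
    intro n
    have hn : (0 : ℝ) < (n : ℝ) + 1 := by positivity
    have e1 : ∫ y in Ioc (0 : ℝ) 1, y ^ n = 1 * 1 * ((n : ℝ) + 1)⁻¹ := by
      rw [← intervalIntegral.integral_of_le zero_le_one, integral_pow]
      simp
    have hscale : Tendsto (fun z : ℝ => ((n : ℝ) + 1) * z) (𝓝[>] 0) (𝓝[>] 0) := by
      refine tendsto_nhdsWithin_iff.2 ⟨?_, hz.mono fun z hz => mul_pos hn hz⟩
      have : Tendsto (fun z : ℝ => ((n : ℝ) + 1) * z) (𝓝 0) (𝓝 (((n : ℝ) + 1) * 0)) :=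
        tendsto_id.const_mul _
      simpa using this.mono_left nhdsWithin_le_nhds
    rw [e1]
    refine (((hlap.comp hscale).mul (hslow n)).mul_const _).congr' ?_
    filter_upwards [hz, hpos, hscale.eventually hpos] with z hz hl hl'
    rw [int_eq z hz hl _ (by fun_prop)]
    have : ∫ t, Real.exp (-z * t) * Real.exp (-z * t) ^ n ∂U
        = ∫ t, Real.exp (-(((n : ℝ) + 1) * z) * t) ∂U := by
      refine integral_congr_ae (Eventually.of_forall fun t => ?_)
      simp only
      rw [← Real.exp_nat_mul, ← Real.exp_add]
      congr 1
      ring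
    rw [this]
    simp only [Function.comp]
    field_simp
  have main : ∀ φ : ℝ → ℝ, Continuous φ →
      Tendsto (fun z => z / ℓ z * ∫ t, Real.exp (-z * t) * φ (Real.exp (-z * t)) ∂U) (𝓝[>] 0)
        (𝓝 (∫ y in Ioc (0 : ℝ) 1, φ y)) := by
    intro φ hφ
    refine (tendsto_integral_of_tendsto_moments hμ hν hmom hφ).congr' ?_
    filter_upwards [hz, hpos] with z hz hl
    exact int_eq z hz hl φ hφ
  have hfin : ∀ z : ℝ, 0 < z → U (Iic z⁻¹) ≠ ∞ := by
    intro z hz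
    have h1 := (hint z hz).measure_norm_ge_lt_top (ε := Real.exp (-1)) (Real.exp_pos _)
    refine ((measure_mono fun t ht => ?_).trans_lt h1).ne
    have : z * t ≤ 1 := by
      have := mul_le_mul_of_nonneg_left (mem_Iic.1 ht) hz.le
      rwa [mul_inv_cancel₀ hz.ne'] at this
    simp only [mem_ofPred_eq, Real.norm_eq_abs, Real.abs_exp]
    exact Real.exp_le_exp.2 (by linarith)
  have hint2 : ∀ z : ℝ, 0 < z → ∀ a b : ℝ, 0 < a →
      Integrable (fun t => Real.exp (-z * t) * cutInv a b (Real.exp (-z * t))) U := by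
    intro z hz a b ha
    refine ((hint z hz).mul_const a⁻¹).mono'
      ((hE z).mul ((continuous_cutInv ha).measurable.comp (hE z))).aestronglyMeasurable
      (Eventually.of_forall fun t => ?_)
    rw [Real.norm_of_nonneg (mul_nonneg (Real.exp_pos _).le (cutInv_nonneg ha))]
    refine mul_le_mul_of_nonneg_left ?_ (Real.exp_pos _).le
    have h1 : max 0 (min 1 ((Real.exp (-z * t) - a) / (b - a))) ≤ 1 :=
      max_le zero_le_one (min_le_left _ _)
    have h2 : (max (Real.exp (-z * t)) a)⁻¹ ≤ a⁻¹ := by gcongr; exact le_max_right _ _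
    calc cutInv a b (Real.exp (-z * t)) ≤ a⁻¹ * 1 := by unfold cutInv; gcongr
      _ = a⁻¹ := mul_one _
  have hind : ∀ z : ℝ, U.real (Iic z⁻¹) = ∫ t, (Iic z⁻¹).indicator (fun _ => (1 : ℝ)) t ∂U :=
    fun z => (integral_indicator_one measurableSet_Iic).symm
  have hindint : ∀ z : ℝ, 0 < z → Integrable ((Iic z⁻¹).indicator fun _ => (1 : ℝ)) U :=
    fun z hz => (integrable_indicator_iff measurableSet_Iic).2 (integrableOn_const (hfin z hz))
  have hthr : ∀ z t : ℝ, 0 < z → (t ≤ z⁻¹ ↔ Real.exp (-1) ≤ Real.exp (-z * t)) := by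
    intro z t hz
    rw [Real.exp_le_exp, ← one_div, le_div_iff₀ hz]
    constructor <;> intro h <;> linarith
  rw [tendsto_order]
  constructor
  · intro r hr
    obtain ⟨s, hs1, hs2⟩ := exists_between (max_lt hr zero_lt_one)
    have hab : Real.exp (-1) < Real.exp (-s) := Real.exp_lt_exp.2 (by linarith)
    have hlim := le_setIntegral_cutInv (Real.exp_pos _) hab
      (Real.exp_le_one_iff.2 (by linarith [(le_max_right r 0).trans_lt hs1]))
    rw [Real.log_exp, neg_neg] at hlim
    filter_upwards [hz, hpos, (main _ (continuous_cutInv (b := Real.exp (-s))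
      (Real.exp_pos (-1)))).eventually_const_lt
        (((le_max_left r 0).trans_lt hs1).trans_le hlim)] with z hz hl hm
    refine hm.trans_le ?_
    rw [mul_div_right_comm, hind]
    refine mul_le_mul_of_nonneg_left (integral_mono (hint2 z hz _ _ (Real.exp_pos _))
      (hindint z hz) fun t => ?_) (by positivity)
    by_cases ht : t ≤ z⁻¹
    · simp only [indicator_of_mem (mem_Iic.2 ht)]
      rw [← mul_inv_cancel₀ (Real.exp_pos (-z * t)).ne']
      exact mul_le_mul_of_nonneg_left (cutInv_le_inv (Real.exp_pos _))
        (Real.exp_pos _).le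
    · have h' := ht
      rw [hthr z t hz, not_le] at h'
      simp only [indicator_of_notMem (show t ∉ Iic z⁻¹ from ht), cutInv_of_le hab h'.le,
        mul_zero, le_refl]
  · intro r hr
    obtain ⟨s, hs1, hs2⟩ := exists_between hr
    have hab : Real.exp (-s) < Real.exp (-1) := Real.exp_lt_exp.2 (by linarith)
    have hlim := setIntegral_cutInv_le (Real.exp_pos _) hab
      (Real.exp_le_one_iff.2 (by linarith))
    rw [Real.log_exp, neg_neg] at hlim
    filter_upwards [hz, hpos, (main _ (continuous_cutInv (b := Real.exp (-1))
      (Real.exp_pos (-s)))).eventually_lt_const (hlim.trans_lt hs2)] with z hz hl hm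
    refine lt_of_le_of_lt ?_ hm
    rw [mul_div_right_comm, hind]
    refine mul_le_mul_of_nonneg_left (integral_mono (hindint z hz)
      (hint2 z hz _ _ (Real.exp_pos _)) fun t => ?_) (by positivity)
    by_cases ht : t ≤ z⁻¹
    · simp only [indicator_of_mem (mem_Iic.2 ht)]
      rw [cutInv_of_ge hab ((hthr z t hz).1 ht), mul_inv_cancel₀ (Real.exp_pos _).ne']
    · simp only [indicator_of_notMem (show t ∉ Iic z⁻¹ from ht)]
      exact mul_nonneg (Real.exp_pos _).le (cutInv_nonneg (Real.exp_pos _))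

/-! ### The Laplace exponent and the tail of the Lévy measure -/

theorem setLIntegral_exp_neg_mul_Ioi {z : ℝ} (hz : 0 < z) (c : ℝ) :
    ∫⁻ t in Ioi c, ENNReal.ofReal (Real.exp (-z * t))
      = ENNReal.ofReal (z⁻¹ * Real.exp (-z * c)) := by
  rw [← ofReal_integral_eq_lintegral_ofReal (integrableOn_exp_mul_Ioi (neg_lt_zero.2 hz) c)
    (Eventually.of_forall fun t => (Real.exp_pos _).le),
    integral_exp_mul_Ioi (neg_lt_zero.2 hz)]
  congr 1
  field_simp

theorem integrableOn_min_one {σ : Measure ℝ}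
    (hσ : ∫⁻ τ in Ioi (0 : ℝ), ENNReal.ofReal (min 1 τ) ∂σ < ∞) :
    IntegrableOn (fun τ : ℝ => min 1 τ) (Ioi 0) σ := by
  refine (lintegral_ofReal_ne_top_iff_integrable (by fun_prop) ?_).1 hσ.ne
  filter_upwards [ae_restrict_mem measurableSet_Ioi] with τ hτ
  exact le_min zero_le_one (mem_Ioi.1 hτ).le

theorem measure_Ioi_ne_top {σ : Measure ℝ}
    (hσ : ∫⁻ τ in Ioi (0 : ℝ), ENNReal.ofReal (min 1 τ) ∂σ < ∞) {t : ℝ} (ht : 0 < t) :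
    σ (Ioi t) ≠ ∞ := by
  have hm : 0 < min 1 t := lt_min one_pos ht
  have h1 := (integrableOn_min_one hσ).measure_norm_ge_lt_top hm
  rw [Measure.restrict_apply' measurableSet_Ioi] at h1
  refine ((measure_mono fun τ hτ => ?_).trans_lt h1).ne
  have hτ' : t < τ := hτ
  refine ⟨?_, ht.trans hτ'⟩
  rw [mem_ofPred_eq, Real.norm_of_nonneg (le_min zero_le_one (ht.trans hτ').le)]
  exact min_le_min_left _ hτ'.le

theorem integrableOn_one_sub_exp {σ : Measure ℝ}
    (hσ : ∫⁻ τ in Ioi (0 : ℝ), ENNReal.ofReal (min 1 τ) ∂σ < ∞) {z : ℝ} (hz : 0 ≤ z) :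
    IntegrableOn (fun τ : ℝ => 1 - Real.exp (-z * τ)) (Ioi 0) σ := by
  refine ((integrableOn_min_one hσ).const_mul (max 1 z)).mono'
    (Measurable.aestronglyMeasurable (by fun_prop)) ?_
  filter_upwards [ae_restrict_mem measurableSet_Ioi] with τ hτ
  have hτ' : (0 : ℝ) < τ := hτ
  have h1 : Real.exp (-z * τ) ≤ 1 := Real.exp_le_one_iff.2 (by nlinarith)
  have h2 := Real.add_one_le_exp (-z * τ)
  rw [Real.norm_of_nonneg (by linarith)]
  rcases min_cases 1 τ with ⟨h, _⟩ | ⟨h, _⟩ <;> rw [h]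
  · linarith [Real.exp_pos (-z * τ), le_max_left 1 z]
  · nlinarith [le_max_right 1 z]

theorem laplaceExponent_pos {σ : Measure ℝ}
    (hσ : ∫⁻ τ in Ioi (0 : ℝ), ENNReal.ofReal (min 1 τ) ∂σ < ∞) (hσ0 : σ (Ioi 0) ≠ 0)
    {z : ℝ} (hz : 0 < z) : 0 < laplaceExponent σ z := by
  have hlt : ∀ τ ∈ Ioi (0 : ℝ), 0 < 1 - Real.exp (-z * τ) := fun τ hτ => by
    have : Real.exp (-z * τ) < 1 := Real.exp_lt_one_iff.2 (by nlinarith [mem_Ioi.1 hτ])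
    linarith
  unfold laplaceExponent
  rw [setIntegral_pos_iff_support_of_nonneg_ae _ (integrableOn_one_sub_exp hσ hz.le)]
  · have hsupp : Ioi (0 : ℝ) ⊆ Function.support fun τ : ℝ => 1 - Real.exp (-z * τ) :=
      fun τ hτ => (hlt τ hτ).ne'
    rw [inter_eq_self_of_subset_right hsupp]
    exact pos_iff_ne_zero.2 hσ0
  · filter_upwards [ae_restrict_mem measurableSet_Ioi] with τ hτ
    exact (hlt τ hτ).le

theorem measurable_measure_Ioi (σ : Measure ℝ) : Measurable fun t : ℝ => σ (Ioi t) :=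
  Antitone.measurable fun _ _ h => measure_mono (Ioi_subset_Ioi h)

/-- The identity `z 𝒦(z) = Φ(z)`, by the layer cake formula applied to
`∫_0^τ e^{-zt} dt = (1 - e^{-zτ}) / z`. -/
theorem lintegral_exp_mul_measure_Ioi {σ : Measure ℝ}
    (hσ : ∫⁻ τ in Ioi (0 : ℝ), ENNReal.ofReal (min 1 τ) ∂σ < ∞) {z : ℝ} (hz : 0 < z) :
    ∫⁻ t in Ioi (0 : ℝ), ENNReal.ofReal (Real.exp (-z * t)) * σ (Ioi t)
      = ENNReal.ofReal (z⁻¹ * laplaceExponent σ z) := by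
  have hcake := lintegral_comp_eq_lintegral_meas_lt_mul (σ.restrict (Ioi (0 : ℝ)))
    (f := fun τ => τ) (g := fun t => Real.exp (-z * t))
    ((ae_restrict_mem measurableSet_Ioi).mono fun τ hτ => (mem_Ioi.1 hτ).le) aemeasurable_id
    (fun t _ => Continuous.intervalIntegrable (by fun_prop) _ _)
    (Eventually.of_forall fun t => (Real.exp_pos _).le)
  have h1 : ∫⁻ t in Ioi (0 : ℝ), ENNReal.ofReal (Real.exp (-z * t)) * σ (Ioi t)
      = ∫⁻ t in Ioi (0 : ℝ), (σ.restrict (Ioi (0 : ℝ))) {a | t < a}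
          * ENNReal.ofReal (Real.exp (-z * t)) := by
    refine setLIntegral_congr_fun measurableSet_Ioi fun t ht => ?_
    rw [mul_comm, Measure.restrict_apply' measurableSet_Ioi]
    congr 2
    ext a
    simp only [mem_Ioi, mem_inter_iff, mem_ofPred_eq]
    exact ⟨fun h => ⟨h, (mem_Ioi.1 ht).trans h⟩, fun h => h.1⟩
  rw [h1, ← hcake, laplaceExponent, ← integral_const_mul,
    ofReal_integral_eq_lintegral_ofReal ((integrableOn_one_sub_exp hσ hz.le).const_mul _) ?_]
  · refine lintegral_congr fun τ => ?_
    congr 1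
    have hd : ∀ t ∈ uIcc 0 τ, HasDerivAt (fun t => -(z⁻¹ * Real.exp (-z * t)))
        (Real.exp (-z * t)) t := by
      intro t _
      have h := (((hasDerivAt_id t).const_mul (-z)).exp.const_mul z⁻¹).neg
      refine h.congr_deriv ?_
      simp only [id]
      field_simp
    rw [intervalIntegral.integral_eq_sub_of_hasDerivAt hd
      (Continuous.intervalIntegrable (by fun_prop) _ _)]
    simp
    ring
  · filter_upwards [ae_restrict_mem measurableSet_Ioi] with τ hτ
    have : Real.exp (-z * τ) ≤ 1 := Real.exp_le_one_iff.2 (by nlinarith [mem_Ioi.1 hτ])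
    exact mul_nonneg (inv_nonneg.2 hz.le) (by linarith)

theorem levyTailLaplace_eq {σ : Measure ℝ}
    (hσ : ∫⁻ τ in Ioi (0 : ℝ), ENNReal.ofReal (min 1 τ) ∂σ < ∞) (hσ0 : σ (Ioi 0) ≠ 0)
    {z : ℝ} (hz : 0 < z) : levyTailLaplace σ z = z⁻¹ * laplaceExponent σ z := by
  have hm : Measurable fun t : ℝ => Real.exp (-z * t) * levyTail σ t :=
    (by fun_prop : Measurable fun t : ℝ => Real.exp (-z * t)).mul
      (measurable_measure_Ioi σ).ennreal_toReal
  rw [levyTailLaplace, integral_eq_lintegral_of_nonneg_ae (f := fun t : ℝ =>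
      Real.exp (-z * t) * levyTail σ t)
    (Eventually.of_forall fun t => mul_nonneg (Real.exp_pos _).le ENNReal.toReal_nonneg)
    hm.aestronglyMeasurable]
  have : ∫⁻ t in Ioi (0 : ℝ), ENNReal.ofReal (Real.exp (-z * t) * levyTail σ t)
      = ∫⁻ t in Ioi (0 : ℝ), ENNReal.ofReal (Real.exp (-z * t)) * σ (Ioi t) := by
    refine setLIntegral_congr_fun measurableSet_Ioi fun t ht => ?_
    rw [ENNReal.ofReal_mul (Real.exp_pos _).le, levyTail,
      ENNReal.ofReal_toReal (measure_Ioi_ne_top hσ ht)]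
  rw [this, lintegral_exp_mul_measure_Ioi hσ hz, ENNReal.toReal_ofReal]
  exact mul_nonneg (inv_nonneg.2 hz.le) (laplaceExponent_pos hσ hσ0 hz).le

/-! ### The density of the inverse process -/

variable {Ω : Type*} [MeasurableSpace Ω]

/-- A jointly measurable version of `(τ, ω) ↦ S τ ω`: by right continuity and monotonicity,
`S τ ω` is almost surely the infimum of the values at the rational times after `τ`. -/
noncomputable def pathVersion (S : ℝ≥0 → Ω → ℝ) (τ : ℝ) (ω : Ω) : ℝ :=
  (⨅ q : ℚ, if τ < q then ENNReal.ofReal (S (q : ℝ).toNNReal ω) else ∞).toReal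

/-- The function `(t, τ) ↦ E[σ((t - S τ, ∞)); S τ < t]`, which for almost every `t > 0` is a
density of the inverse process at time `t`. -/
noncomputable def inverseDensityVersion (S : ℝ≥0 → Ω → ℝ) (P : Measure Ω) (σ : Measure ℝ)
    (t τ : ℝ) : ℝ≥0∞ :=
  ∫⁻ ω, (Ioi (0 : ℝ)).indicator (fun u => σ (Ioi u)) (t - pathVersion S τ ω) ∂P

theorem measurable_pathVersion {S : ℝ≥0 → Ω → ℝ} (hS : ∀ t, Measurable (S t)) :
    Measurable fun p : ℝ × Ω => pathVersion S p.1 p.2 := by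
  refine (Measurable.iInf fun q => ?_).ennreal_toReal
  refine Measurable.ite (measurableSet_lt measurable_fst measurable_const) ?_ measurable_const
  exact ((hS _).comp measurable_snd).ennreal_ofReal

theorem IsSubordinator.ae_path {S : ℝ≥0 → Ω → ℝ} {P : Measure Ω} (hS : IsSubordinator S P) :
    ∀ᵐ ω ∂P, (∀ t, 0 ≤ S t ω) ∧ S 0 ω = 0 ∧ (Monotone fun t => S t ω) ∧
      ∀ t, ContinuousWithinAt (fun s => S s ω) (Ici t) t := by
  filter_upwards [hS.zero, hS.monotone, hS.rightContinuous] with ω h0 hm hr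
  exact ⟨fun t => h0 ▸ hm zero_le, h0, hm, hr⟩

theorem exists_gt_lt_of_rightContinuous {f : ℝ≥0 → ℝ} {t : ℝ≥0}
    (hr : ContinuousWithinAt f (Ici t) t) {c : ℝ} (hc : f t < c) : ∃ u, t < u ∧ f u < c := by
  have h1 : ∀ᶠ s in 𝓝[>] t, f s < c :=
    (hr.mono Ioi_subset_Ici_self).eventually_lt_const hc
  have h2 : ∀ᶠ s in 𝓝[>] t, t < s := eventually_mem_nhdsWithin
  obtain ⟨u, hu⟩ := (h2.and h1).exists
  exact ⟨u, hu⟩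

theorem IsSubordinator.ae_pathVersion_eq {S : ℝ≥0 → Ω → ℝ} {P : Measure Ω}
    (hS : IsSubordinator S P) :
    ∀ᵐ ω ∂P, ∀ τ : ℝ≥0, pathVersion S τ ω = S τ ω := by
  filter_upwards [hS.ae_path] with ω ⟨h0, _, hm, hr⟩ τ
  have : (⨅ q : ℚ, if (τ : ℝ) < q then ENNReal.ofReal (S (q : ℝ).toNNReal ω) else ∞)
      = ENNReal.ofReal (S τ ω) := by
    apply le_antisymm
    · refine le_of_forall_gt fun c hc => ?_
      rcases eq_or_ne c ∞ with rfl | hctop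
      · obtain ⟨q, hq⟩ := exists_rat_gt (τ : ℝ)
        refine (iInf_le _ q).trans_lt ?_
        rw [if_pos hq]
        exact ENNReal.ofReal_lt_top
      · have hc' : S τ ω < c.toReal := (ENNReal.ofReal_lt_iff_lt_toReal (h0 τ) hctop).1 hc
        obtain ⟨u, hu, huc⟩ := exists_gt_lt_of_rightContinuous (hr τ) hc'
        obtain ⟨q, hq1, hq2⟩ := exists_rat_btwn (NNReal.coe_lt_coe.2 hu)
        refine (iInf_le _ q).trans_lt ?_
        rw [if_pos hq1]
        refine (ENNReal.ofReal_lt_iff_lt_toReal (h0 _) hctop).2 (lt_of_le_of_lt (hm ?_) huc)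
        exact Real.toNNReal_le_iff_le_coe.2 hq2.le
    · refine le_iInf fun q => ?_
      split_ifs with hq
      · exact ENNReal.ofReal_le_ofReal (hm (NNReal.le_toNNReal_of_coe_le hq.le))
      · exact le_top
  rw [pathVersion, this, ENNReal.toReal_ofReal (h0 τ)]

variable {S : ℝ≥0 → Ω → ℝ} {P : Measure Ω} {σ : Measure ℝ}

theorem IsSubordinator.ae_pathVersion (hS : IsSubordinator S P) {τ : ℝ} (hτ : 0 ≤ τ) :
    ∀ᵐ ω ∂P, pathVersion S τ ω = S τ.toNNReal ω := by
  filter_upwards [hS.ae_pathVersion_eq] with ω h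
  simpa [hτ] using h τ.toNNReal

theorem IsSubordinator.lintegral_exp_pathVersion [IsProbabilityMeasure P]
    (hS : IsSubordinator S P) (hσ : HasLevyMeasure S P σ) {τ z : ℝ} (hτ : 0 ≤ τ) (hz : 0 ≤ z) :
    ∫⁻ ω, ENNReal.ofReal (Real.exp (-z * pathVersion S τ ω)) ∂P
      = ENNReal.ofReal (Real.exp (-(laplaceExponent σ z) * τ)) := by
  have h1 : ∫⁻ ω, ENNReal.ofReal (Real.exp (-z * pathVersion S τ ω)) ∂P
      = ∫⁻ ω, ENNReal.ofReal (Real.exp (-z * S τ.toNNReal ω)) ∂P := by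
    refine lintegral_congr_ae ?_
    filter_upwards [hS.ae_pathVersion hτ] with ω h
    rw [h]
  have hm := hS.measurable τ.toNNReal
  have hi : Integrable (fun ω => Real.exp (-z * S τ.toNNReal ω)) P := by
    refine Integrable.of_bound (by fun_prop) 1 ?_
    filter_upwards [hS.ae_path] with ω h
    rw [Real.norm_of_nonneg (Real.exp_pos _).le]
    exact Real.exp_le_one_iff.2 (by nlinarith [h.1 τ.toNNReal])
  rw [h1, ← ofReal_integral_eq_lintegral_ofReal hi
    (Eventually.of_forall fun ω => (Real.exp_pos _).le), hσ.laplace _ _ hz,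
    Real.coe_toNNReal _ hτ]
  congr 2
  ring

theorem measurable_pathVersion_right (hS : ∀ t, Measurable (S t)) (τ : ℝ) :
    Measurable (pathVersion S τ) :=
  (measurable_pathVersion hS).comp measurable_prodMk_left

theorem measurable_indicator_measure_Ioi (σ : Measure ℝ) :
    Measurable ((Ioi (0 : ℝ)).indicator fun u => σ (Ioi u)) :=
  (measurable_measure_Ioi σ).indicator measurableSet_Ioi

theorem measurable_inverseDensityVersion [SFinite P] (hS : ∀ t, Measurable (S t)) :
    Measurable fun p : ℝ × ℝ => inverseDensityVersion S P σ p.1 p.2 := by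
  refine Measurable.lintegral_prod_right' (f := fun x : (ℝ × ℝ) × Ω =>
    (Ioi (0 : ℝ)).indicator (fun u => σ (Ioi u)) (x.1.1 - pathVersion S x.1.2 x.2)) ?_
  refine (measurable_indicator_measure_Ioi σ).comp ?_
  exact (measurable_fst.comp measurable_fst).sub ((measurable_pathVersion hS).comp
    ((measurable_snd.comp measurable_fst).prodMk measurable_snd))

theorem setLIntegral_comp_sub_Ioi {g : ℝ → ℝ≥0∞} (hg : Measurable g) {z T : ℝ} (hT : 0 ≤ T) :
    ∫⁻ t in Ioi (0 : ℝ), ENNReal.ofReal (Real.exp (-z * t)) * (Ioi (0 : ℝ)).indicator g (t - T)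
      = ENNReal.ofReal (Real.exp (-z * T))
        * ∫⁻ u in Ioi (0 : ℝ), ENNReal.ofReal (Real.exp (-z * u)) * g u := by
  have hG : Measurable fun u : ℝ => ENNReal.ofReal (Real.exp (-z * u)) * g u := by fun_prop
  have h1 : ∀ t : ℝ, (Ioi (0 : ℝ)).indicator (fun t => ENNReal.ofReal (Real.exp (-z * t)) *
      (Ioi (0 : ℝ)).indicator g (t - T)) t
      = ENNReal.ofReal (Real.exp (-z * T)) * (Ioi (0 : ℝ)).indicator
        (fun u => ENNReal.ofReal (Real.exp (-z * u)) * g u) (t - T) := by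
    intro t
    by_cases ht : 0 < t - T
    · rw [indicator_of_mem (show t ∈ Ioi (0 : ℝ) by simp only [mem_Ioi]; linarith),
        indicator_of_mem (show t - T ∈ Ioi (0 : ℝ) from ht),
        indicator_of_mem (show t - T ∈ Ioi (0 : ℝ) from ht), ← mul_assoc,
        ← ENNReal.ofReal_mul (Real.exp_pos _).le, ← Real.exp_add]
      congr 3
      ring
    · have ht' : t - T ∉ Ioi (0 : ℝ) := ht
      rw [indicator_of_notMem ht', mul_zero]
      by_cases h0 : t ∈ Ioi (0 : ℝ)
      · rw [indicator_of_mem h0, indicator_of_notMem ht', mul_zero]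
      · rw [indicator_of_notMem h0]
  rw [← lintegral_indicator measurableSet_Ioi, lintegral_congr h1,
    lintegral_const_mul' _ _ ENNReal.ofReal_ne_top,
    lintegral_sub_right_eq_self (μ := volume) (fun u => (Ioi (0 : ℝ)).indicator
        (fun u => ENNReal.ofReal (Real.exp (-z * u)) * g u) u) T,
    lintegral_indicator measurableSet_Ioi]

/-- The Laplace transform of `t ↦ E[g(t - S τ); S τ < t]` factorizes. -/
theorem IsSubordinator.laplace_lintegral_comp_sub [IsProbabilityMeasure P]
    (hS : IsSubordinator S P) (hσ : HasLevyMeasure S P σ) {g : ℝ → ℝ≥0∞} (hg : Measurable g)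
    {τ z : ℝ} (hτ : 0 ≤ τ) (hz : 0 ≤ z) :
    ∫⁻ t in Ioi (0 : ℝ), ENNReal.ofReal (Real.exp (-z * t))
        * ∫⁻ ω, (Ioi (0 : ℝ)).indicator g (t - pathVersion S τ ω) ∂P
      = ENNReal.ofReal (Real.exp (-(laplaceExponent σ z) * τ))
        * ∫⁻ u in Ioi (0 : ℝ), ENNReal.ofReal (Real.exp (-z * u)) * g u := by
  have hT := measurable_pathVersion_right hS.measurable τ
  have hgi : Measurable ((Ioi (0 : ℝ)).indicator g) := hg.indicator measurableSet_Ioi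
  calc _ = ∫⁻ t in Ioi (0 : ℝ), ∫⁻ ω, ENNReal.ofReal (Real.exp (-z * t))
        * (Ioi (0 : ℝ)).indicator g (t - pathVersion S τ ω) ∂P :=
        lintegral_congr fun t => (lintegral_const_mul' _ _ ENNReal.ofReal_ne_top).symm
    _ = ∫⁻ ω, (∫⁻ t in Ioi (0 : ℝ), ENNReal.ofReal (Real.exp (-z * t))
        * (Ioi (0 : ℝ)).indicator g (t - pathVersion S τ ω)) ∂P := by
        refine lintegral_lintegral_swap (Measurable.aemeasurable ?_)
        refine Measurable.mul (by fun_prop) (hgi.comp ?_)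
        exact measurable_fst.sub (hT.comp measurable_snd)
    _ = ∫⁻ ω, ENNReal.ofReal (Real.exp (-z * pathVersion S τ ω))
        * (∫⁻ u in Ioi (0 : ℝ), ENNReal.ofReal (Real.exp (-z * u)) * g u) ∂P :=
        lintegral_congr fun ω => setLIntegral_comp_sub_Ioi hg ENNReal.toReal_nonneg
    _ = _ := by
        rw [lintegral_mul_const _ (by fun_prop), hS.lintegral_exp_pathVersion hσ hτ hz]

theorem IsSubordinator.laplace_inverseDensityVersion [IsProbabilityMeasure P]
    (hS : IsSubordinator S P) (hσ : HasLevyMeasure S P σ) {τ z : ℝ} (hτ : 0 ≤ τ) (hz : 0 < z) :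
    ∫⁻ t in Ioi (0 : ℝ), ENNReal.ofReal (Real.exp (-z * t)) * inverseDensityVersion S P σ t τ
      = ENNReal.ofReal (Real.exp (-(laplaceExponent σ z) * τ))
        * ENNReal.ofReal (z⁻¹ * laplaceExponent σ z) := by
  rw [← lintegral_exp_mul_measure_Ioi hσ.lintegral_min_lt_top hz]
  exact hS.laplace_lintegral_comp_sub hσ (measurable_measure_Ioi σ) hτ hz.le

theorem IsSubordinator.laplace_measure_lt [IsProbabilityMeasure P]
    (hS : IsSubordinator S P) (hσ : HasLevyMeasure S P σ) {τ z : ℝ} (hτ : 0 ≤ τ) (hz : 0 < z) :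
    ∫⁻ t in Ioi (0 : ℝ), ENNReal.ofReal (Real.exp (-z * t)) * P {ω | pathVersion S τ ω < t}
      = ENNReal.ofReal (Real.exp (-(laplaceExponent σ z) * τ)) * ENNReal.ofReal z⁻¹ := by
  have h1 := hS.laplace_lintegral_comp_sub hσ (g := fun _ => 1) measurable_const hτ hz.le
  simp only [mul_one, setLIntegral_exp_neg_mul_Ioi hz, mul_zero, Real.exp_zero] at h1
  rw [← h1]
  refine lintegral_congr fun t => ?_
  congr 1
  rw [← lintegral_indicator_one
    (measurableSet_lt (measurable_pathVersion_right hS.measurable τ) measurable_const)]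
  refine lintegral_congr fun ω => ?_
  simp [indicator]

/-- The distribution function of the inverse process, through the density. Both sides have the
Laplace transform `e^{-s Φ(z)} / z` in `t`. -/
theorem IsSubordinator.ae_measure_lt_eq [IsProbabilityMeasure P]
    (hS : IsSubordinator S P) (hσ : HasLevyMeasure S P σ) {s : ℝ} (hs : 0 ≤ s) :
    ∀ᵐ t ∂(volume.restrict (Ioi (0 : ℝ))), P {ω | pathVersion S s ω < t}
      = ∫⁻ τ in Ioi s, inverseDensityVersion S P σ t τ := by
  have hmeas := measurable_inverseDensityVersion (P := P) (σ := σ) hS.measurable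
  have hσ0 : σ (Ioi 0) ≠ 0 := by simp [hσ.infinite_mass]
  refine ae_eq_of_laplace_eq (a := fun t => P {ω | pathVersion S s ω < t}) ?_
    hmeas.lintegral_prod_right' ?_ ?_
  · exact Monotone.measurable fun t t' h => measure_mono fun ω (hω : _ < t) => hω.trans_le h
  · intro z hz
    have hΦ := laplaceExponent_pos hσ.lintegral_min_lt_top hσ0 hz
    rw [hS.laplace_measure_lt hσ hs hz]
    symm
    calc _ = ∫⁻ t in Ioi (0 : ℝ), ∫⁻ τ in Ioi s, ENNReal.ofReal (Real.exp (-z * t))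
          * inverseDensityVersion S P σ t τ :=
          lintegral_congr fun t => (lintegral_const_mul' _ _ ENNReal.ofReal_ne_top).symm
      _ = ∫⁻ τ in Ioi s, ∫⁻ t in Ioi (0 : ℝ), ENNReal.ofReal (Real.exp (-z * t))
          * inverseDensityVersion S P σ t τ :=
          lintegral_lintegral_swap
            (Measurable.aemeasurable (Measurable.mul (by fun_prop) hmeas))
      _ = ∫⁻ τ in Ioi s, ENNReal.ofReal (Real.exp (-(laplaceExponent σ z) * τ))
        * ENNReal.ofReal (z⁻¹ * laplaceExponent σ z) :=
          setLIntegral_congr_fun measurableSet_Ioi fun τ hτ =>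
            hS.laplace_inverseDensityVersion hσ (hs.trans (mem_Ioi.1 hτ).le) hz
      _ = _ := by
          rw [lintegral_mul_const _ (by fun_prop), setLIntegral_exp_neg_mul_Ioi hΦ,
            ← ENNReal.ofReal_mul (by positivity), ← ENNReal.ofReal_mul (by positivity)]
          congr 1
          field_simp
  · intro z hz
    rw [hS.laplace_measure_lt hσ hs hz]
    exact ENNReal.mul_ne_top ENNReal.ofReal_ne_top ENNReal.ofReal_ne_top

/-- The paths are almost surely unbounded: `e^{-t} P(∀ s, S s < t) ≤ E[e^{-S n}] = e^{-nΦ(1)}` for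
every `n`. -/
theorem IsSubordinator.ae_exists_le [IsProbabilityMeasure P]
    (hS : IsSubordinator S P) (hσ : HasLevyMeasure S P σ) (t : ℝ) :
    ∀ᵐ ω ∂P, ∃ s, t ≤ S s ω := by
  have hσ0 : σ (Ioi 0) ≠ 0 := by simp [hσ.infinite_mass]
  have hΦ := laplaceExponent_pos hσ.lintegral_min_lt_top hσ0 one_pos
  have hbound : ∀ n : ℕ, ENNReal.ofReal (Real.exp (-t)) * P {ω | ∀ s, S s ω < t}
      ≤ ENNReal.ofReal (Real.exp (-(laplaceExponent σ 1) * n)) := by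
    intro n
    have hn : (0 : ℝ) ≤ n := n.cast_nonneg
    rw [← hS.lintegral_exp_pathVersion hσ hn zero_le_one]
    have hm := measurable_pathVersion_right hS.measurable n
    refine le_trans ?_ (mul_meas_ge_le_lintegral (by fun_prop) (ENNReal.ofReal (Real.exp (-t))))
    refine mul_le_mul_right (measure_mono_ae ?_) _
    filter_upwards [hS.ae_pathVersion hn] with ω h hω
    refine ENNReal.ofReal_le_ofReal (Real.exp_le_exp.2 ?_)
    rw [h]
    have : S (n : ℝ).toNNReal ω < t := hω _
    linarith
  have hlim : Tendsto (fun n : ℕ => ENNReal.ofReal (Real.exp (-(laplaceExponent σ 1) * n)))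
      atTop (𝓝 0) := by
    rw [← ENNReal.ofReal_zero]
    refine ENNReal.tendsto_ofReal (Real.tendsto_exp_atBot.comp ?_)
    exact tendsto_natCast_atTop_atTop.const_mul_atTop_of_neg (neg_lt_zero.2 hΦ)
  have h0 := le_antisymm (ge_of_tendsto' hlim hbound) zero_le
  rw [ae_iff]
  simp only [not_exists, not_le]
  refine (mul_eq_zero.1 h0).resolve_left ?_
  simp [Real.exp_pos]

theorem lt_sInf_iff_of_rightContinuous {f : ℝ≥0 → ℝ} (hm : Monotone f) {s : ℝ≥0}
    (hr : ContinuousWithinAt f (Ici s) s) {t : ℝ} (hne : ∃ u, t ≤ f u) :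
    s < sInf {u | t ≤ f u} ↔ f s < t := by
  constructor
  · intro h
    by_contra! hle
    exact absurd (csInf_le (s := {u | t ≤ f u}) (OrderBot.bddBelow _) hle) (not_le.2 h)
  · intro h
    obtain ⟨u, hu, hut⟩ := exists_gt_lt_of_rightContinuous hr h
    refine hu.trans_le (le_csInf hne fun v hv => ?_)
    by_contra! hvu
    exact absurd (hm hvu.le) (not_le.2 (hut.trans_le hv))

theorem IsSubordinator.ae_lt_inverseProcess_iff [IsProbabilityMeasure P]
    (hS : IsSubordinator S P) (hσ : HasLevyMeasure S P σ) (t : ℝ) {s : ℝ} (hs : 0 ≤ s) :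
    ∀ᵐ ω ∂P, s < inverseProcess S t ω ↔ pathVersion S s ω < t := by
  filter_upwards [hS.ae_path, hS.ae_exists_le hσ t, hS.ae_pathVersion hs] with ω h1 h2 h3
  rw [h3, ← lt_sInf_iff_of_rightContinuous h1.2.2.1 (h1.2.2.2 _) h2, inverseProcess,
    ← NNReal.coe_lt_coe, Real.coe_toNNReal _ hs]

theorem IsSubordinator.measure_lt_inverseProcess [IsProbabilityMeasure P]
    (hS : IsSubordinator S P) (hσ : HasLevyMeasure S P σ) (t : ℝ) {s : ℝ} (hs : 0 ≤ s) :
    P {ω | s < inverseProcess S t ω} = P {ω | pathVersion S s ω < t} :=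
  measure_congr <| (hS.ae_lt_inverseProcess_iff hσ t hs).mono fun _ h => propext h

theorem IsSubordinator.aemeasurable_inverseProcess [IsProbabilityMeasure P]
    (hS : IsSubordinator S P) (hσ : HasLevyMeasure S P σ) (t : ℝ) :
    AEMeasurable (inverseProcess S t) P := by
  have h : NullMeasurable (inverseProcess S t) P := by
    refine @measurable_of_Ioi ℝ (NullMeasurableSpace Ω P) _ _ _ _ _ _ _ _ fun s => ?_
    change NullMeasurableSet {ω | s < inverseProcess S t ω} P
    rcases lt_or_ge s 0 with hs | hs
    · have : {ω | s < inverseProcess S t ω} = univ :=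
        eq_univ_of_forall fun ω => hs.trans_le (NNReal.coe_nonneg _)
      rw [this]
      exact nullMeasurableSet_univ
    · refine (measurableSet_lt (measurable_pathVersion_right hS.measurable s)
        measurable_const).nullMeasurableSet.congr (t := {ω | s < inverseProcess S t ω})
          (s := {ω | pathVersion S s ω < t}) ?_
      filter_upwards [hS.ae_lt_inverseProcess_iff hσ t hs] with ω h
      exact propext h.symm
  exact h.aemeasurable

/-- For almost every `t` the law of the inverse process at time `t` has the density
`inverseDensityVersion`. Half-lines with rational endpoints are used in order to have one null set
of times for all of them. -/
theorem IsSubordinator.ae_map_inverseProcess [IsProbabilityMeasure P]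
    (hS : IsSubordinator S P) (hσ : HasLevyMeasure S P σ) :
    ∀ᵐ t ∂(volume.restrict (Ioi (0 : ℝ))), P.map (inverseProcess S t)
      = volume.withDensity ((Ioi 0).indicator (inverseDensityVersion S P σ t)) := by
  have hall : ∀ᵐ t ∂(volume.restrict (Ioi (0 : ℝ))), ∀ q : ℚ, (0 : ℝ) ≤ q →
      P {ω | pathVersion S q ω < t} = ∫⁻ τ in Ioi (q : ℝ), inverseDensityVersion S P σ t τ := by
    refine ae_all_iff.2 fun q => ?_
    by_cases hq : (0 : ℝ) ≤ q
    · filter_upwards [hS.ae_measure_lt_eq hσ hq] with t ht _ using ht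
    · exact Eventually.of_forall fun t h => absurd h hq
  filter_upwards [hall, ae_restrict_mem measurableSet_Ioi] with t ht ht0
  have hE := hS.aemeasurable_inverseProcess hσ t
  have : IsProbabilityMeasure (P.map (inverseProcess S t)) := Measure.isProbabilityMeasure_map hE
  have hone : P {ω | pathVersion S (0 : ℝ) ω < t} = 1 := by
    rw [← prob_compl_eq_zero_iff (measurableSet_lt
      (measurable_pathVersion_right hS.measurable 0) measurable_const)]
    refine (ae_iff (p := fun ω => pathVersion S (0 : ℝ) ω < t)).1 ?_
    filter_upwards [hS.ae_pathVersion le_rfl, hS.zero] with ω h1 h2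
    rw [h1, Real.toNNReal_zero, h2]
    exact ht0
  have hdens : ∫⁻ τ in Ioi (0 : ℝ), inverseDensityVersion S P σ t τ = 1 := by
    have := ht 0 (by simp)
    rw [Rat.cast_zero, hone] at this
    exact this.symm
  have hW : ∀ A : Set ℝ, MeasurableSet A →
      volume.withDensity ((Ioi 0).indicator (inverseDensityVersion S P σ t)) A
        = ∫⁻ τ in Ioi 0 ∩ A, inverseDensityVersion S P σ t τ := by
    intro A hA
    rw [withDensity_apply _ hA, setLIntegral_indicator measurableSet_Ioi]
  refine ext_of_generate_finite _
    (BorelSpace.measurable_eq.trans Real.borel_eq_generateFrom_Ioi_rat)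
    Real.isPiSystem_Ioi_rat ?_ ?_
  · intro A hA
    obtain ⟨q, rfl⟩ : ∃ q : ℚ, A = Ioi (q : ℝ) := by
      simpa [eq_comm] using hA
    rw [hW _ measurableSet_Ioi, Measure.map_apply_of_aemeasurable hE measurableSet_Ioi]
    change P {ω | (q : ℝ) < inverseProcess S t ω} = _
    rcases lt_or_ge (q : ℝ) 0 with hq | hq
    · have h1 : {ω | (q : ℝ) < inverseProcess S t ω} = univ :=
        eq_univ_of_forall fun ω => hq.trans_le (NNReal.coe_nonneg _)
      rw [h1, measure_univ, inter_eq_self_of_subset_left (Ioi_subset_Ioi hq.le), hdens]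
    · rw [hS.measure_lt_inverseProcess hσ t hq, ht q hq,
        inter_eq_self_of_subset_right (Ioi_subset_Ioi hq)]
  · rw [hW _ MeasurableSet.univ, measure_univ, inter_univ, hdens]

theorem IsSubordinator.ae_hasPDF_inverseProcess [IsProbabilityMeasure P]
    (hS : IsSubordinator S P) (hσ : HasLevyMeasure S P σ) :
    ∀ᵐ t ∂(volume.restrict (Ioi (0 : ℝ))), HasPDF (inverseProcess S t) P volume ∧
      ∀ᵐ τ ∂(volume.restrict (Ioi (0 : ℝ))),
        ENNReal.ofReal (inverseDensity S P t τ) = inverseDensityVersion S P σ t τ := by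
  filter_upwards [hS.ae_map_inverseProcess hσ] with t ht
  have hm : Measurable ((Ioi 0).indicator (inverseDensityVersion S P σ t)) :=
    ((measurable_inverseDensityVersion hS.measurable).comp measurable_prodMk_left).indicator
      measurableSet_Ioi
  have hpdf : HasPDF (inverseProcess S t) P volume :=
    hasPDF_of_map_eq_withDensity (hS.aemeasurable_inverseProcess hσ t) _ hm.aemeasurable ht
  refine ⟨hpdf, ?_⟩
  have h1 := (pdf.eq_of_map_eq_withDensity' _ hm.aemeasurable).1 ht
  have h5 : (fun τ => ENNReal.ofReal (pdf (inverseProcess S t) P volume τ).toReal)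
      =ᵐ[volume] pdf (inverseProcess S t) P volume := pdf.ofReal_toReal_ae_eq
  filter_upwards [ae_restrict_of_ae h1, ae_restrict_of_ae h5,
    ae_restrict_mem measurableSet_Ioi] with τ h2 h3 h4
  rw [inverseDensity, h3, h2, indicator_of_mem h4]

/-! ### Laplace transforms of subordinated functions -/

/-- Karamata's theorem for the Cesàro mean of a nonnegative function. -/
theorem cesaroMean_isEquivalent {f ℓ : ℝ → ℝ} (hf : ∀ t, 0 ≤ f t)
    (hint : ∀ z : ℝ, 0 < z → IntegrableOn (fun t => Real.exp (-z * t) * f t) (Ioi 0))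
    (hpos : ∀ᶠ z in 𝓝[>] (0 : ℝ), 0 < ℓ z)
    (hslow : ∀ n : ℕ, Tendsto (fun z => ℓ (((n : ℝ) + 1) * z) / ℓ z) (𝓝[>] 0) (𝓝 1))
    (hlap : Tendsto (fun z => z * (∫ t in Ioi (0 : ℝ), Real.exp (-z * t) * f t) / ℓ z)
      (𝓝[>] 0) (𝓝 1)) :
    cesaroMean f ~[atTop] fun t => ℓ t⁻¹ := by
  have hfm : AEMeasurable f (volume.restrict (Ioi 0)) := by
    have h := (hint 1 one_pos).aestronglyMeasurable.aemeasurable.mul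
      (by fun_prop : AEMeasurable (fun t : ℝ => Real.exp t) (volume.restrict (Ioi 0)))
    refine h.congr (Eventually.of_forall fun t => ?_)
    simp only [Pi.mul_apply]
    rw [mul_right_comm, ← Real.exp_add]
    simp
  let U : Measure ℝ := (volume.restrict (Ioi (0 : ℝ))).withDensity fun t => ENNReal.ofReal (f t)
  have hU : ∀ᵐ t ∂U, 0 ≤ t := by
    have h : ∀ᵐ t ∂(volume.restrict (Ioi (0 : ℝ))), 0 ≤ t :=
      (ae_restrict_mem measurableSet_Ioi).mono fun t ht => (mem_Ioi.1 ht).le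
    exact (withDensity_absolutelyContinuous _ _).ae_le h
  have hfin : ∀ᵐ t ∂(volume.restrict (Ioi (0 : ℝ))), ENNReal.ofReal (f t) < ∞ :=
    Eventually.of_forall fun t => ENNReal.ofReal_lt_top
  have hsmul : ∀ z : ℝ, (fun t => (ENNReal.ofReal (f t)).toReal • Real.exp (-z * t))
      = fun t => Real.exp (-z * t) * f t := fun z => by
    ext t
    rw [ENNReal.toReal_ofReal (hf t), smul_eq_mul, mul_comm]
  have hUint : ∀ z : ℝ, 0 < z → Integrable (fun t => Real.exp (-z * t)) U := by
    intro z hz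
    rw [integrable_withDensity_iff_integrable_smul₀' hfm.ennreal_ofReal hfin, hsmul]
    exact hint z hz
  have hUlap : ∀ z : ℝ, ∫ t, Real.exp (-z * t) ∂U
      = ∫ t in Ioi (0 : ℝ), Real.exp (-z * t) * f t := by
    intro z
    rw [integral_withDensity_eq_integral_toReal_smul₀ hfm.ennreal_ofReal hfin, hsmul]
  have hUreal : ∀ T : ℝ, 0 < T → U.real (Iic T) = ∫ s in (0 : ℝ)..T, f s := by
    intro T hT
    have hsub : Ioc 0 T ⊆ Ioi 0 := Ioc_subset_Ioi_self
    rw [intervalIntegral.integral_of_le hT.le, integral_eq_lintegral_of_nonneg_ae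
      (Eventually.of_forall hf) (hfm.mono_set hsub).aestronglyMeasurable, Measure.real,
      withDensity_apply _ measurableSet_Iic, Measure.restrict_restrict measurableSet_Iic,
      inter_comm, Ioi_inter_Iic]
  have key := karamata hU hUint hpos hslow (by simpa only [hUlap] using hlap)
  have key' := key.comp tendsto_inv_atTop_nhdsGT_zero
  have hpos' := tendsto_inv_atTop_nhdsGT_zero.eventually hpos
  refine (isEquivalent_iff_tendsto_one (hpos'.mono fun t ht => ht.ne')).2 (key'.congr' ?_)
  filter_upwards [eventually_gt_atTop 0] with t ht
  simp only [Function.comp, Pi.div_apply, inv_inv, cesaroMean, hUreal t ht, one_div]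

theorem inverseDensity_nonneg (S : ℝ≥0 → Ω → ℝ) (P : Measure Ω) (t τ : ℝ) :
    0 ≤ inverseDensity S P t τ := ENNReal.toReal_nonneg

theorem IsSubordinator.laplace_lintegral_mul_inverseDensityVersion [IsProbabilityMeasure P]
    (hS : IsSubordinator S P) (hσ : HasLevyMeasure S P σ) {w : ℝ → ℝ} (hwm : Measurable w)
    (hw0 : ∀ τ, 0 < τ → 0 ≤ w τ)
    (hw : ∀ p : ℝ, 0 < p → IntegrableOn (fun τ => Real.exp (-p * τ) * w τ) (Ioi 0))
    {z : ℝ} (hz : 0 < z) :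
    ∫⁻ t in Ioi (0 : ℝ), ENNReal.ofReal (Real.exp (-z * t))
        * ∫⁻ τ in Ioi (0 : ℝ), ENNReal.ofReal (w τ) * inverseDensityVersion S P σ t τ
      = ENNReal.ofReal (z⁻¹ * laplaceExponent σ z
        * ∫ τ in Ioi (0 : ℝ), Real.exp (-(laplaceExponent σ z) * τ) * w τ) := by
  have hg := measurable_inverseDensityVersion (P := P) (σ := σ) hS.measurable
  have hσ0 : σ (Ioi 0) ≠ 0 := by simp [hσ.infinite_mass]
  have hΦ := laplaceExponent_pos hσ.lintegral_min_lt_top hσ0 hz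
  calc _ = ∫⁻ t in Ioi (0 : ℝ), ∫⁻ τ in Ioi (0 : ℝ), ENNReal.ofReal (Real.exp (-z * t))
        * (ENNReal.ofReal (w τ) * inverseDensityVersion S P σ t τ) :=
        lintegral_congr fun t => (lintegral_const_mul' _ _ ENNReal.ofReal_ne_top).symm
    _ = ∫⁻ τ in Ioi (0 : ℝ), ∫⁻ t in Ioi (0 : ℝ), ENNReal.ofReal (Real.exp (-z * t))
        * (ENNReal.ofReal (w τ) * inverseDensityVersion S P σ t τ) := by
        refine lintegral_lintegral_swap (Measurable.aemeasurable (Measurable.mul (by fun_prop)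
          (Measurable.mul ?_ hg)))
        exact (hwm.comp measurable_snd).ennreal_ofReal
    _ = ∫⁻ τ in Ioi (0 : ℝ), ENNReal.ofReal (z⁻¹ * laplaceExponent σ z) *
        ENNReal.ofReal (Real.exp (-(laplaceExponent σ z) * τ) * w τ) := by
        refine setLIntegral_congr_fun measurableSet_Ioi fun τ hτ => ?_
        simp_rw [mul_left_comm _ (ENNReal.ofReal (w τ))]
        rw [lintegral_const_mul' _ _ ENNReal.ofReal_ne_top,
          hS.laplace_inverseDensityVersion hσ (mem_Ioi.1 hτ).le hz,
          ENNReal.ofReal_mul (Real.exp_pos _).le]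
        ring
    _ = _ := by
        rw [lintegral_const_mul' _ _ ENNReal.ofReal_ne_top,
          ENNReal.ofReal_mul (mul_nonneg (inv_nonneg.2 hz.le) hΦ.le),
          ofReal_integral_eq_lintegral_ofReal (hw _ hΦ)]
        filter_upwards [ae_restrict_mem measurableSet_Ioi] with τ hτ
        exact mul_nonneg (Real.exp_pos _).le (hw0 τ hτ)

theorem IsSubordinator.ae_integrableOn_mul_inverseDensity [IsProbabilityMeasure P]
    (hS : IsSubordinator S P) (hσ : HasLevyMeasure S P σ) {w : ℝ → ℝ} (hwm : Measurable w)
    (hw0 : ∀ τ, 0 < τ → 0 ≤ w τ)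
    (hw : ∀ p : ℝ, 0 < p → IntegrableOn (fun τ => Real.exp (-p * τ) * w τ) (Ioi 0)) :
    ∀ᵐ t ∂(volume.restrict (Ioi (0 : ℝ))), HasPDF (inverseProcess S t) P volume ∧
      IntegrableOn (fun τ => w τ * inverseDensity S P t τ) (Ioi 0) ∧
      ENNReal.ofReal (∫ τ in Ioi (0 : ℝ), w τ * inverseDensity S P t τ)
        = ∫⁻ τ in Ioi (0 : ℝ), ENNReal.ofReal (w τ) * inverseDensityVersion S P σ t τ := by
  have hg := measurable_inverseDensityVersion (P := P) (σ := σ) hS.measurable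
  have hm : Measurable fun t =>
      ∫⁻ τ in Ioi (0 : ℝ), ENNReal.ofReal (w τ) * inverseDensityVersion S P σ t τ :=
    Measurable.lintegral_prod_right' (f := fun p : ℝ × ℝ => ENNReal.ofReal (w p.2)
      * inverseDensityVersion S P σ p.1 p.2)
      ((hwm.comp measurable_snd).ennreal_ofReal.mul hg)
  have hfin := ae_lt_top (μ := volume.restrict (Ioi (0 : ℝ)))
    (f := fun t => ENNReal.ofReal (Real.exp (-1 * t))
      * ∫⁻ τ in Ioi (0 : ℝ), ENNReal.ofReal (w τ) * inverseDensityVersion S P σ t τ)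
    (Measurable.mul (by fun_prop) hm)
    (by
      rw [hS.laplace_lintegral_mul_inverseDensityVersion hσ hwm hw0 hw one_pos]
      exact ENNReal.ofReal_ne_top)
  filter_upwards [hfin, hS.ae_hasPDF_inverseProcess hσ] with t ht ⟨hpdf, hdens⟩
  have hnn : 0 ≤ᵐ[volume.restrict (Ioi 0)] fun τ => w τ * inverseDensity S P t τ :=
    (ae_restrict_mem measurableSet_Ioi).mono fun τ hτ =>
      mul_nonneg (hw0 τ hτ) (inverseDensity_nonneg S P t τ)
  have hmeas : AEStronglyMeasurable (fun τ => w τ * inverseDensity S P t τ)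
      (volume.restrict (Ioi 0)) :=
    (hwm.mul (measurable_pdf (inverseProcess S t) P volume).ennreal_toReal).aestronglyMeasurable
  have heq : ∫⁻ τ in Ioi (0 : ℝ), ENNReal.ofReal (w τ * inverseDensity S P t τ)
      = ∫⁻ τ in Ioi (0 : ℝ), ENNReal.ofReal (w τ) * inverseDensityVersion S P σ t τ := by
    refine lintegral_congr_ae ?_
    filter_upwards [hdens, ae_restrict_mem measurableSet_Ioi] with τ h1 h2
    rw [ENNReal.ofReal_mul (hw0 τ h2), h1]
  have hne : ∫⁻ τ in Ioi (0 : ℝ), ENNReal.ofReal (w τ) * inverseDensityVersion S P σ t τ ≠ ∞ := by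
    intro h
    rw [h, ENNReal.mul_top (by simp [Real.exp_pos])] at ht
    exact lt_irrefl _ ht
  have hint : IntegrableOn (fun τ => w τ * inverseDensity S P t τ) (Ioi 0) :=
    (lintegral_ofReal_ne_top_iff_integrable hmeas hnn).1 (heq ▸ hne)
  exact ⟨hpdf, hint, by rw [ofReal_integral_eq_lintegral_ofReal hint hnn, heq]⟩

/-- The Laplace transform in time of the subordination of `w` is
`z⁻¹ Φ(z) ∫ e^{-Φ(z) τ} w(τ) dτ`. -/
theorem IsSubordinator.laplace_subordinated [IsProbabilityMeasure P]
    (hS : IsSubordinator S P) (hσ : HasLevyMeasure S P σ) {w : ℝ → ℝ} (hwm : Measurable w)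
    (hw0 : ∀ τ, 0 < τ → 0 ≤ w τ)
    (hw : ∀ p : ℝ, 0 < p → IntegrableOn (fun τ => Real.exp (-p * τ) * w τ) (Ioi 0))
    {z : ℝ} (hz : 0 < z) :
    IntegrableOn (fun t => Real.exp (-z * t)
        * ∫ τ in Ioi (0 : ℝ), w τ * inverseDensity S P t τ) (Ioi 0) ∧
      ∫ t in Ioi (0 : ℝ), Real.exp (-z * t) * ∫ τ in Ioi (0 : ℝ), w τ * inverseDensity S P t τ
        = z⁻¹ * laplaceExponent σ z
          * ∫ τ in Ioi (0 : ℝ), Real.exp (-(laplaceExponent σ z) * τ) * w τ := by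
  have hg := measurable_inverseDensityVersion (P := P) (σ := σ) hS.measurable
  have hσ0 : σ (Ioi 0) ≠ 0 := by simp [hσ.infinite_mass]
  have hΦ := laplaceExponent_pos hσ.lintegral_min_lt_top hσ0 hz
  have hm : Measurable fun t =>
      ∫⁻ τ in Ioi (0 : ℝ), ENNReal.ofReal (w τ) * inverseDensityVersion S P σ t τ :=
    Measurable.lintegral_prod_right' (f := fun p : ℝ × ℝ => ENNReal.ofReal (w p.2)
      * inverseDensityVersion S P σ p.1 p.2)
      ((hwm.comp measurable_snd).ennreal_ofReal.mul hg)
  have hf0 : ∀ t, 0 ≤ ∫ τ in Ioi (0 : ℝ), w τ * inverseDensity S P t τ := fun t =>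
    setIntegral_nonneg measurableSet_Ioi fun τ hτ =>
      mul_nonneg (hw0 τ hτ) (inverseDensity_nonneg S P t τ)
  have hae : ∀ᵐ t ∂(volume.restrict (Ioi (0 : ℝ))),
      ENNReal.ofReal (∫ τ in Ioi (0 : ℝ), w τ * inverseDensity S P t τ)
        = ∫⁻ τ in Ioi (0 : ℝ), ENNReal.ofReal (w τ) * inverseDensityVersion S P σ t τ :=
    (hS.ae_integrableOn_mul_inverseDensity hσ hwm hw0 hw).mono fun t ht => ht.2.2
  have hfm : AEMeasurable (fun t => ∫ τ in Ioi (0 : ℝ), w τ * inverseDensity S P t τ)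
      (volume.restrict (Ioi 0)) := by
    refine hm.ennreal_toReal.aemeasurable.congr ?_
    filter_upwards [hae] with t ht
    rw [← ht, ENNReal.toReal_ofReal (hf0 t)]
  have hnn : 0 ≤ᵐ[volume.restrict (Ioi 0)] fun t => Real.exp (-z * t)
      * ∫ τ in Ioi (0 : ℝ), w τ * inverseDensity S P t τ :=
    Eventually.of_forall fun t => mul_nonneg (Real.exp_pos _).le (hf0 t)
  have hmeas : AEStronglyMeasurable (fun t => Real.exp (-z * t)
      * ∫ τ in Ioi (0 : ℝ), w τ * inverseDensity S P t τ) (volume.restrict (Ioi 0)) :=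
    (AEMeasurable.mul (by fun_prop) hfm).aestronglyMeasurable
  have heq : ∫⁻ t in Ioi (0 : ℝ), ENNReal.ofReal (Real.exp (-z * t)
      * ∫ τ in Ioi (0 : ℝ), w τ * inverseDensity S P t τ)
      = ENNReal.ofReal (z⁻¹ * laplaceExponent σ z
        * ∫ τ in Ioi (0 : ℝ), Real.exp (-(laplaceExponent σ z) * τ) * w τ) := by
    rw [← hS.laplace_lintegral_mul_inverseDensityVersion hσ hwm hw0 hw hz]
    refine lintegral_congr_ae ?_
    filter_upwards [hae] with t ht
    rw [ENNReal.ofReal_mul (Real.exp_pos _).le, ht]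
  refine ⟨(lintegral_ofReal_ne_top_iff_integrable hmeas hnn).1
    (heq ▸ ENNReal.ofReal_ne_top), ?_⟩
  rw [integral_eq_lintegral_of_nonneg_ae hnn hmeas, heq, ENNReal.toReal_ofReal]
  refine mul_nonneg (mul_nonneg (inv_nonneg.2 hz.le) hΦ.le)
    (setIntegral_nonneg measurableSet_Ioi fun τ hτ => ?_)
  exact mul_nonneg (Real.exp_pos _).le (hw0 τ hτ)

/-! ### The resolvent of the heat kernel near zero -/

/-- The heat kernel in dimension `d` at time `τ` and distance `r` from the origin. -/
noncomputable def radialKernel (d : ℕ) (r τ : ℝ) : ℝ :=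
  (2 * Real.pi * τ) ^ (-(d : ℝ) / 2) * Real.exp (-r ^ 2 / (2 * τ))

/-- The resolvent kernel `∫_0^∞ e^{-pτ} v(x,τ) dτ` at distance `|x| = r`. -/
noncomputable def resolvent (d : ℕ) (r p : ℝ) : ℝ :=
  ∫ τ in Ioi (0 : ℝ), Real.exp (-p * τ) * radialKernel d r τ

theorem measurable_radialKernel (d : ℕ) (r : ℝ) : Measurable (radialKernel d r) := by
  unfold radialKernel; fun_prop

theorem radialKernel_pos (d : ℕ) (r : ℝ) {τ : ℝ} (hτ : 0 < τ) : 0 < radialKernel d r τ := by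
  have := Real.pi_pos
  unfold radialKernel; positivity

theorem radialKernel_le_rpow (d : ℕ) (r : ℝ) {τ : ℝ} (hτ : 0 < τ) :
    radialKernel d r τ ≤ (2 * Real.pi * τ) ^ (-(d : ℝ) / 2) := by
  have := Real.pi_pos
  refine mul_le_of_le_one_right (by positivity) (Real.exp_le_one_iff.2 ?_)
  rw [neg_div]
  exact neg_nonpos.2 (by positivity)

/-- Away from the origin the heat kernel is bounded in time. -/
theorem exists_radialKernel_le {d : ℕ} (hd : 0 < d) {r : ℝ} (hr : r ≠ 0) :
    ∃ B, ∀ τ, 0 < τ → radialKernel d r τ ≤ B := by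
  have hπ := Real.pi_pos
  set s : ℝ := (d : ℝ) / 2 with hs
  have hs0 : 0 < s := by positivity
  have hr2 : 0 < r ^ 2 := by positivity
  refine ⟨(s / (Real.pi * r ^ 2)) ^ s, fun τ hτ => ?_⟩
  -- With `y = π r² / s · (2πτ)⁻¹` this is the inequality `y ≤ e^y`, raised to the power `s`.
  set y : ℝ := Real.pi * r ^ 2 / s * (2 * Real.pi * τ)⁻¹ with hy
  have hy0 : 0 < y := by positivity
  have h1 : (2 * Real.pi * τ)⁻¹ = s / (Real.pi * r ^ 2) * y := by
    rw [hy]; field_simp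
  have h2 : -r ^ 2 / (2 * τ) = -(y * s) := by
    rw [hy]; field_simp
  have h3 : y ^ s ≤ Real.exp (y * s) := by
    rw [Real.exp_mul]
    exact Real.rpow_le_rpow hy0.le (by linarith [Real.add_one_le_exp y]) hs0.le
  rw [radialKernel, neg_div, ← hs, Real.rpow_neg (by positivity),
    ← Real.inv_rpow (by positivity), h1, Real.mul_rpow (by positivity) hy0.le, h2, Real.exp_neg,
    mul_assoc]
  refine mul_le_of_le_one_right (by positivity) ?_
  rw [← div_eq_mul_inv]
  exact (div_le_one (Real.exp_pos _)).2 h3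

theorem integrableOn_exp_mul_inv_sqrt {p : ℝ} (hp : 0 < p) :
    IntegrableOn (fun τ : ℝ => Real.exp (-p * τ) * (2 * Real.pi * τ) ^ (-(1 : ℝ) / 2))
      (Ioi 0) := by
  have hπ := Real.pi_pos
  have h := (integrableOn_rpow_mul_exp_neg_mul_rpow (p := 1) (s := -1 / 2) (b := p)
    (by norm_num) one_pos hp).const_mul ((2 * Real.pi) ^ (-(1 : ℝ) / 2))
  refine IntegrableOn.congr_fun h (fun τ hτ => ?_) measurableSet_Ioi
  rw [Real.mul_rpow (by positivity) (mem_Ioi.1 hτ).le, Real.rpow_one]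
  ring

theorem integrableOn_exp_mul_radialKernel {d : ℕ} {r : ℝ} (h : d = 1 ∨ 0 < d ∧ r ≠ 0)
    {p : ℝ} (hp : 0 < p) :
    IntegrableOn (fun τ => Real.exp (-p * τ) * radialKernel d r τ) (Ioi 0) := by
  have hm : AEStronglyMeasurable (fun τ => Real.exp (-p * τ) * radialKernel d r τ)
      (volume.restrict (Ioi 0)) :=
    (Measurable.mul (by fun_prop) (measurable_radialKernel d r)).aestronglyMeasurable
  rcases h with rfl | ⟨hd, hr⟩
  · refine (integrableOn_exp_mul_inv_sqrt hp).mono' hm ?_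
    filter_upwards [ae_restrict_mem measurableSet_Ioi] with τ hτ
    rw [Real.norm_of_nonneg (mul_nonneg (Real.exp_pos _).le (radialKernel_pos 1 r hτ).le)]
    have := radialKernel_le_rpow 1 r hτ
    rw [Nat.cast_one] at this
    gcongr
  · obtain ⟨B, hB⟩ := exists_radialKernel_le hd hr
    refine ((integrableOn_exp_mul_Ioi (neg_lt_zero.2 hp) 0).mul_const B).mono' hm ?_
    filter_upwards [ae_restrict_mem measurableSet_Ioi] with τ hτ
    rw [Real.norm_of_nonneg (mul_nonneg (Real.exp_pos _).le (radialKernel_pos d r hτ).le)]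
    exact mul_le_mul_of_nonneg_left (hB τ hτ) (Real.exp_pos _).le

/-- The constant `∫_0^∞ e^{-u} (2πu)^{-1/2} du` of the one-dimensional resolvent at `0`. -/
noncomputable def resolventConstOne : ℝ :=
  ∫ u in Ioi (0 : ℝ), Real.exp (-1 * u) * (2 * Real.pi * u) ^ (-(1 : ℝ) / 2)

theorem setIntegral_Ioi_pos {f : ℝ → ℝ} (hf : IntegrableOn f (Ioi 0))
    (hpos : ∀ t, 0 < t → 0 < f t) : 0 < ∫ t in Ioi (0 : ℝ), f t := by
  rw [setIntegral_pos_iff_support_of_nonneg_ae _ hf]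
  · have hsupp : Ioi (0 : ℝ) ⊆ Function.support f := fun t ht => (hpos t ht).ne'
    rw [inter_eq_self_of_subset_right hsupp]
    simp
  · filter_upwards [ae_restrict_mem measurableSet_Ioi] with t ht
    exact (hpos t ht).le

theorem resolventConstOne_pos : 0 < resolventConstOne := by
  have hπ := Real.pi_pos
  exact setIntegral_Ioi_pos (integrableOn_exp_mul_inv_sqrt one_pos) fun u hu => by positivity

/-- The substitution `u = pτ` in the one-dimensional resolvent. -/
theorem sqrt_mul_resolvent_one (r : ℝ) {p : ℝ} (hp : 0 < p) :
    p ^ (1 / 2 : ℝ) * resolvent 1 r p = ∫ u in Ioi (0 : ℝ), Real.exp (-1 * u)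
      * (2 * Real.pi * u) ^ (-(1 : ℝ) / 2) * Real.exp (-r ^ 2 * p / (2 * u)) := by
  have hπ := Real.pi_pos
  have h := integral_comp_mul_left_Ioi (fun u => Real.exp (-1 * u)
      * (2 * Real.pi * u) ^ (-(1 : ℝ) / 2) * Real.exp (-r ^ 2 * p / (2 * u))) 0 hp
  rw [mul_zero, smul_eq_mul, eq_inv_mul_iff_mul_eq₀ hp.ne'] at h
  rw [← h, resolvent, ← integral_const_mul, ← integral_const_mul]
  refine setIntegral_congr_fun measurableSet_Ioi fun τ hτ => ?_
  have hτ' : (0 : ℝ) < τ := hτ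
  have e1 : (2 * Real.pi * (p * τ)) ^ (-(1 : ℝ) / 2)
      = p ^ (-(1 : ℝ) / 2) * (2 * Real.pi * τ) ^ (-(1 : ℝ) / 2) := by
    rw [← Real.mul_rpow hp.le (by positivity)]
    ring_nf
  have e2 : p * p ^ (-(1 : ℝ) / 2) = p ^ (1 / 2 : ℝ) := by
    nth_rewrite 1 [← Real.rpow_one p]
    rw [← Real.rpow_add hp]
    norm_num
  have e3 : -r ^ 2 * p / (2 * (p * τ)) = -r ^ 2 / (2 * τ) := by field_simp
  simp only [radialKernel, Nat.cast_one]
  rw [e1, e3, ← e2]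
  ring_nf

theorem tendsto_sqrt_mul_resolvent_one (r : ℝ) :
    Tendsto (fun p => p ^ (1 / 2 : ℝ) * resolvent 1 r p) (𝓝[>] 0) (𝓝 resolventConstOne) := by
  have hπ := Real.pi_pos
  have hev : ∀ᶠ p in 𝓝[>] (0 : ℝ), 0 < p := eventually_mem_nhdsWithin
  have hlim : Tendsto (fun p : ℝ => ∫ u in Ioi (0 : ℝ), Real.exp (-1 * u)
      * (2 * Real.pi * u) ^ (-(1 : ℝ) / 2) * Real.exp (-r ^ 2 * p / (2 * u)))
      (𝓝[>] 0) (𝓝 resolventConstOne) := by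
    refine tendsto_integral_filter_of_dominated_convergence _
      (Eventually.of_forall fun p => Measurable.aestronglyMeasurable (by fun_prop)) ?_
      (integrableOn_exp_mul_inv_sqrt one_pos) ?_
    · filter_upwards [hev] with p hp
      filter_upwards [ae_restrict_mem measurableSet_Ioi] with u hu
      have hu' : (0 : ℝ) < u := hu
      rw [Real.norm_of_nonneg (by positivity)]
      refine mul_le_of_le_one_right (by positivity) (Real.exp_le_one_iff.2 ?_)
      rw [neg_mul, neg_div]
      exact neg_nonpos.2 (by positivity)
    · refine Eventually.of_forall fun u => ?_
      have hc : Continuous fun p : ℝ => Real.exp (-1 * u) * (2 * Real.pi * u) ^ (-(1 : ℝ) / 2)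
          * Real.exp (-r ^ 2 * p / (2 * u)) := by fun_prop
      have h0 := (hc.tendsto 0).mono_left (nhdsWithin_le_nhds (s := Ioi 0))
      simpa using h0
  exact hlim.congr' (hev.mono fun p hp => (sqrt_mul_resolvent_one r hp).symm)

theorem two_pi_mul_radialKernel_two (r : ℝ) {τ : ℝ} (hτ : 0 < τ) :
    2 * Real.pi * radialKernel 2 r τ = τ⁻¹ * Real.exp (-(r ^ 2 / 2) / τ) := by
  have hπ := Real.pi_pos
  have h1 : (2 * Real.pi * τ) ^ (-((2 : ℕ) : ℝ) / 2) = (2 * Real.pi * τ)⁻¹ := by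
    rw [← Real.rpow_neg_one]; norm_num
  have h2 : -r ^ 2 / (2 * τ) = -(r ^ 2 / 2) / τ := by field_simp
  rw [radialKernel, h1, h2]
  field_simp

/-- Upper bound of the two-dimensional resolvent: the logarithm comes from `1 ≤ τ ≤ 1/p`, and the
two other ranges contribute bounded terms. -/
theorem two_pi_mul_resolvent_two_le {r : ℝ} (hr : r ≠ 0) {p : ℝ} (hp : 0 < p) (hp1 : p ≤ 1) :
    2 * Real.pi * resolvent 2 r p ≤ Real.log (1 / p) + ((r ^ 2 / 2)⁻¹ + 1) := by
  set a : ℝ := r ^ 2 / 2 with ha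
  have ha0 : 0 < a := by positivity
  have hint := (integrableOn_exp_mul_radialKernel (d := 2) (r := r)
    (Or.inr ⟨two_pos, hr⟩) hp).const_mul (2 * Real.pi)
  have h1p : 1 ≤ 1 / p := by rwa [le_div_iff₀ hp, one_mul]
  have hp0 : (0 : ℝ) < 1 / p := by positivity
  have hval : ∀ τ : ℝ, 0 < τ → 2 * Real.pi * (Real.exp (-p * τ) * radialKernel 2 r τ)
      = Real.exp (-p * τ) * (τ⁻¹ * Real.exp (-a / τ)) := fun τ hτ => by
    rw [← two_pi_mul_radialKernel_two r hτ]; ring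
  have hexp1 : ∀ τ : ℝ, 0 < τ → Real.exp (-p * τ) ≤ 1 := fun τ hτ =>
    Real.exp_le_one_iff.2 (by nlinarith)
  have hexp2 : ∀ τ : ℝ, 0 < τ → Real.exp (-a / τ) ≤ 1 := fun τ hτ =>
    Real.exp_le_one_iff.2 (by rw [neg_div]; exact neg_nonpos.2 (by positivity))
  have hinvint : IntegrableOn (fun τ : ℝ => τ⁻¹) (Ioc 1 (1 / p)) := by
    rw [← intervalIntegrable_iff_integrableOn_Ioc_of_le h1p]
    exact intervalIntegral.intervalIntegrable_inv (fun y hy => by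
      rw [uIcc_of_le h1p] at hy; exact (one_pos.trans_le hy.1).ne') continuousOn_id
  have hs1 : Ioi (0 : ℝ) = Ioc 0 1 ∪ (Ioc 1 (1 / p) ∪ Ioi (1 / p)) := by
    rw [Ioc_union_Ioi_eq_Ioi h1p, Ioc_union_Ioi_eq_Ioi zero_le_one]
  have hsub1 : Ioc (0 : ℝ) 1 ⊆ Ioi 0 := Ioc_subset_Ioi_self
  have hsub2 : Ioc (1 : ℝ) (1 / p) ⊆ Ioi 0 := fun τ hτ => one_pos.trans hτ.1
  have hsub3 : Ioi (1 / p) ⊆ Ioi 0 := Ioi_subset_Ioi hp0.le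
  have b1 : ∫ τ in Ioc (0 : ℝ) 1, 2 * Real.pi * (Real.exp (-p * τ) * radialKernel 2 r τ)
      ≤ a⁻¹ := by
    have : ∫ τ in Ioc (0 : ℝ) 1, 2 * Real.pi * (Real.exp (-p * τ) * radialKernel 2 r τ)
        ≤ ∫ τ in Ioc (0 : ℝ) 1, a⁻¹ := by
      refine setIntegral_mono_on (IntegrableOn.mono_set hint hsub1) (by simp) measurableSet_Ioc
        fun τ hτ => ?_
      rw [hval τ hτ.1]
      have hx : τ⁻¹ * Real.exp (-a / τ) ≤ a⁻¹ := by
        have h := Real.add_one_le_exp (a / τ)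
        rw [neg_div, Real.exp_neg, ← mul_inv]
        refine inv_anti₀ ha0 ?_
        have hτ0 := hτ.1
        calc a = τ * (a / τ) := by field_simp
          _ ≤ τ * Real.exp (a / τ) := by gcongr; linarith
      have h0 : 0 ≤ τ⁻¹ * Real.exp (-a / τ) :=
        mul_nonneg (inv_nonneg.2 hτ.1.le) (Real.exp_pos _).le
      exact (mul_le_of_le_one_left h0 (hexp1 τ hτ.1)).trans hx
    simpa using this
  have b2 : ∫ τ in Ioc (1 : ℝ) (1 / p), 2 * Real.pi * (Real.exp (-p * τ) * radialKernel 2 r τ)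
      ≤ Real.log (1 / p) := by
    have : ∫ τ in Ioc (1 : ℝ) (1 / p), 2 * Real.pi * (Real.exp (-p * τ) * radialKernel 2 r τ)
        ≤ ∫ τ in Ioc (1 : ℝ) (1 / p), τ⁻¹ := by
      refine setIntegral_mono_on (IntegrableOn.mono_set hint hsub2) hinvint measurableSet_Ioc
        fun τ hτ => ?_
      have hτ0 : 0 < τ := hsub2 hτ
      rw [hval τ hτ0]
      calc Real.exp (-p * τ) * (τ⁻¹ * Real.exp (-a / τ)) ≤ 1 * (τ⁻¹ * 1) := by
            gcongr
            · exact hexp1 τ hτ0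
            · exact hexp2 τ hτ0
        _ = τ⁻¹ := by ring
    rwa [← intervalIntegral.integral_of_le h1p (f := fun τ : ℝ => τ⁻¹),
      integral_inv_of_pos one_pos hp0, div_one] at this
  have b3 : ∫ τ in Ioi (1 / p), 2 * Real.pi * (Real.exp (-p * τ) * radialKernel 2 r τ) ≤ 1 := by
    have hexpint := integrableOn_exp_mul_Ioi (neg_lt_zero.2 hp) (1 / p)
    have : ∫ τ in Ioi (1 / p), 2 * Real.pi * (Real.exp (-p * τ) * radialKernel 2 r τ)
        ≤ ∫ τ in Ioi (1 / p), p * Real.exp (-p * τ) := by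
      refine setIntegral_mono_on (IntegrableOn.mono_set hint hsub3) (hexpint.const_mul p)
        measurableSet_Ioi fun τ hτ => ?_
      have hτ0 : 0 < τ := hsub3 hτ
      have hinv : τ⁻¹ ≤ p := by
        rw [inv_le_comm₀ hτ0 hp, ← one_div]; exact (mem_Ioi.1 hτ).le
      rw [hval τ hτ0]
      calc Real.exp (-p * τ) * (τ⁻¹ * Real.exp (-a / τ)) ≤ Real.exp (-p * τ) * (p * 1) := by
            gcongr
            exact hexp2 τ hτ0
        _ = p * Real.exp (-p * τ) := by ring
    refine this.trans ?_
    rw [integral_const_mul, integral_exp_mul_Ioi (neg_lt_zero.2 hp)]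
    have : p * (-Real.exp (-p * (1 / p)) / -p) = Real.exp (-1) := by
      rw [neg_mul, mul_one_div_cancel hp.ne']
      field_simp
    rw [this]
    exact Real.exp_le_one_iff.2 (by norm_num)
  have hdisj : Disjoint (Ioc (0 : ℝ) 1) (Ioc 1 (1 / p) ∪ Ioi (1 / p)) := by
    rw [Ioc_union_Ioi_eq_Ioi h1p]
    exact Ioc_disjoint_Ioi le_rfl
  rw [resolvent, ← integral_const_mul, hs1, setIntegral_union hdisj
    (measurableSet_Ioc.union measurableSet_Ioi) (IntegrableOn.mono_set hint hsub1)
    (IntegrableOn.mono_set hint (union_subset hsub2 hsub3)),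
    setIntegral_union (Ioc_disjoint_Ioi le_rfl) measurableSet_Ioi
      (IntegrableOn.mono_set hint hsub2) (IntegrableOn.mono_set hint hsub3)]
  linarith

/-- Lower bound of the two-dimensional resolvent, from `1 - u ≤ e^{-u}` on the range
`1 ≤ τ ≤ 1/p`. -/
theorem le_two_pi_mul_resolvent_two {r : ℝ} (hr : r ≠ 0) {p : ℝ} (hp : 0 < p) (hp1 : p ≤ 1) :
    Real.log (1 / p) - (r ^ 2 / 2 + 1) ≤ 2 * Real.pi * resolvent 2 r p := by
  have hπ := Real.pi_pos
  set a : ℝ := r ^ 2 / 2 with ha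
  have ha0 : 0 < a := by positivity
  have hint := (integrableOn_exp_mul_radialKernel (d := 2) (r := r)
    (Or.inr ⟨two_pos, hr⟩) hp).const_mul (2 * Real.pi)
  have h1p : 1 ≤ 1 / p := by rwa [le_div_iff₀ hp, one_mul]
  have hp0 : (0 : ℝ) < 1 / p := by positivity
  have hsub2 : Ioc (1 : ℝ) (1 / p) ⊆ Ioi 0 := fun τ hτ => one_pos.trans hτ.1
  have hne : ∀ τ ∈ uIcc 1 (1 / p), τ ≠ 0 := fun τ hτ => by
    rw [uIcc_of_le h1p] at hτ; exact (one_pos.trans_le hτ.1).ne'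
  have hi1 : IntervalIntegrable (fun τ : ℝ => τ⁻¹) volume 1 (1 / p) :=
    intervalIntegral.intervalIntegrable_inv hne continuousOn_id
  have hi2 : IntervalIntegrable (fun τ : ℝ => a * (τ ^ 2)⁻¹) volume 1 (1 / p) :=
    (intervalIntegral.intervalIntegrable_inv (fun τ hτ => pow_ne_zero 2 (hne τ hτ))
      (by fun_prop)).const_mul a
  have hi3 : IntervalIntegrable (fun _ : ℝ => p) volume 1 (1 / p) := intervalIntegrable_const
  have hI2 : ∫ τ in (1 : ℝ)..(1 / p), a * (τ ^ 2)⁻¹ = a * (1 - p) := by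
    rw [intervalIntegral.integral_const_mul]
    congr 1
    have hd : ∀ τ ∈ uIcc 1 (1 / p), HasDerivAt (fun τ : ℝ => -τ⁻¹) ((τ ^ 2)⁻¹) τ := fun τ hτ => by
      simpa using (hasDerivAt_inv (hne τ hτ)).fun_neg
    rw [intervalIntegral.integral_eq_sub_of_hasDerivAt hd
      (intervalIntegral.intervalIntegrable_inv (fun τ hτ => pow_ne_zero 2 (hne τ hτ))
      (by fun_prop))]
    simp
    ring
  have hbound : ∫ τ in (1 : ℝ)..(1 / p), (τ⁻¹ - a * (τ ^ 2)⁻¹ - p)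
      ≤ ∫ τ in (1 : ℝ)..(1 / p), 2 * Real.pi * (Real.exp (-p * τ) * radialKernel 2 r τ) := by
    refine intervalIntegral.integral_mono_on h1p ((hi1.sub hi2).sub hi3)
      ((intervalIntegrable_iff_integrableOn_Ioc_of_le h1p).2
        (IntegrableOn.mono_set hint hsub2)) fun τ hτ => ?_
    have hτ0 : 0 < τ := one_pos.trans_le hτ.1
    have h1 : 2 * Real.pi * (Real.exp (-p * τ) * radialKernel 2 r τ)
        = τ⁻¹ * Real.exp (-p * τ + -a / τ) := by
      rw [Real.exp_add, mul_left_comm, two_pi_mul_radialKernel_two r hτ0]; ring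
    have h2 : τ⁻¹ - a * (τ ^ 2)⁻¹ - p = τ⁻¹ * ((-p * τ + -a / τ) + 1) := by
      field_simp
      ring
    rw [h1, h2]
    exact mul_le_mul_of_nonneg_left (Real.add_one_le_exp _) (inv_nonneg.2 hτ0.le)
  rw [intervalIntegral.integral_sub (hi1.sub hi2) hi3, intervalIntegral.integral_sub hi1 hi2, hI2,
    integral_inv_of_pos one_pos hp0, intervalIntegral.integral_const,
    intervalIntegral.integral_of_le h1p, div_one, smul_eq_mul] at hbound
  have hset : ∫ τ in Ioc (1 : ℝ) (1 / p), 2 * Real.pi * (Real.exp (-p * τ) * radialKernel 2 r τ)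
      ≤ ∫ τ in Ioi (0 : ℝ), 2 * Real.pi * (Real.exp (-p * τ) * radialKernel 2 r τ) := by
    refine setIntegral_mono_set hint ?_ hsub2.eventuallyLE
    filter_upwards [ae_restrict_mem measurableSet_Ioi] with τ hτ
    have := radialKernel_pos 2 r hτ
    change 0 ≤ _
    positivity
  rw [integral_const_mul (2 * Real.pi) (μ := volume.restrict (Ioi (0 : ℝ)))] at hset
  have hpp : (1 / p - 1) * p = 1 - p := by field_simp
  rw [hpp] at hbound
  have : resolvent 2 r p = ∫ τ in Ioi (0 : ℝ), Real.exp (-p * τ) * radialKernel 2 r τ := rfl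
  rw [this]
  nlinarith

theorem tendsto_log_one_div_nhdsGT_zero :
    Tendsto (fun p : ℝ => Real.log (1 / p)) (𝓝[>] 0) atTop := by
  simp only [one_div]
  exact Real.tendsto_log_atTop.comp tendsto_inv_nhdsGT_zero

theorem tendsto_resolvent_two_div_log {r : ℝ} (hr : r ≠ 0) :
    Tendsto (fun p => resolvent 2 r p / Real.log (1 / p)) (𝓝[>] 0) (𝓝 (2 * Real.pi)⁻¹) := by
  have hπ := Real.pi_pos
  have hlog := tendsto_log_one_div_nhdsGT_zero
  have hc : ∀ c : ℝ, Tendsto (fun p : ℝ => 1 + c / Real.log (1 / p)) (𝓝[>] 0) (𝓝 1) := fun c => by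
    simpa using (hlog.const_div_atTop c).const_add 1
  have hev : ∀ᶠ p in 𝓝[>] (0 : ℝ), 0 < p ∧ p ≤ 1 ∧ 0 < Real.log (1 / p) := by
    filter_upwards [Ioc_mem_nhdsGT (zero_lt_one' ℝ), hlog.eventually_gt_atTop 0] with p hp hl
    exact ⟨hp.1, hp.2, hl⟩
  have main : Tendsto (fun p => 2 * Real.pi * resolvent 2 r p / Real.log (1 / p))
      (𝓝[>] 0) (𝓝 1) := by
    refine tendsto_of_tendsto_of_tendsto_of_le_of_le' (hc (-(r ^ 2 / 2 + 1)))
      (hc ((r ^ 2 / 2)⁻¹ + 1)) ?_ ?_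
    · filter_upwards [hev] with p ⟨h0, h1, hl⟩
      rw [le_div_iff₀ hl, add_mul, div_mul_cancel₀ _ hl.ne']
      linarith [le_two_pi_mul_resolvent_two hr h0 h1]
    · filter_upwards [hev] with p ⟨h0, h1, hl⟩
      rw [div_le_iff₀ hl, add_mul, div_mul_cancel₀ _ hl.ne']
      linarith [two_pi_mul_resolvent_two_le hr h0 h1]
  have h2 := main.const_mul (2 * Real.pi)⁻¹
  rw [mul_one] at h2
  refine h2.congr fun p => ?_
  field_simp

theorem integrableOn_radialKernel {d : ℕ} (hd : 3 ≤ d) {r : ℝ} (hr : r ≠ 0) :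
    IntegrableOn (radialKernel d r) (Ioi 0) := by
  have hπ := Real.pi_pos
  have hd' : (3 : ℝ) ≤ d := by exact_mod_cast hd
  rw [← Ioc_union_Ioi_eq_Ioi (zero_le_one' ℝ)]
  refine IntegrableOn.union ?_ ?_
  · obtain ⟨B, hB⟩ := exists_radialKernel_le (by lia : 0 < d) hr
    refine Measure.integrableOn_of_bounded (M := B) (by simp)
      (measurable_radialKernel d r).aestronglyMeasurable ?_
    filter_upwards [ae_restrict_mem measurableSet_Ioc] with τ hτ
    rw [Real.norm_of_nonneg (radialKernel_pos d r hτ.1).le]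
    exact hB τ hτ.1
  · refine ((integrableOn_Ioi_rpow_of_lt (a := -(d : ℝ) / 2) (by linarith) one_pos).const_mul
      ((2 * Real.pi) ^ (-(d : ℝ) / 2))).mono' (measurable_radialKernel d r).aestronglyMeasurable ?_
    filter_upwards [ae_restrict_mem measurableSet_Ioi] with τ hτ
    have hτ0 : 0 < τ := one_pos.trans hτ
    rw [Real.norm_of_nonneg (radialKernel_pos d r hτ0).le, ← Real.mul_rpow (by positivity) hτ0.le]
    exact radialKernel_le_rpow d r hτ0

/-- The Newtonian kernel scales as `r ^ (2 - d)`. -/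
theorem integral_radialKernel (d : ℕ) {r : ℝ} (hr : 0 < r) :
    ∫ τ in Ioi (0 : ℝ), radialKernel d r τ
      = (∫ τ in Ioi (0 : ℝ), radialKernel d 1 τ) * r ^ (2 - (d : ℝ)) := by
  have hπ := Real.pi_pos
  have hr2 : 0 < r ^ 2 := by positivity
  have h := integral_comp_mul_left_Ioi (radialKernel d r) 0 hr2
  rw [mul_zero, smul_eq_mul, eq_inv_mul_iff_mul_eq₀ hr2.ne'] at h
  rw [← h, ← integral_const_mul, ← integral_mul_const]
  refine setIntegral_congr_fun measurableSet_Ioi fun τ hτ => ?_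
  have hτ0 : (0 : ℝ) < τ := hτ
  have e1 : (2 * Real.pi * (r ^ 2 * τ)) ^ (-(d : ℝ) / 2)
      = r ^ (-(d : ℝ)) * (2 * Real.pi * τ) ^ (-(d : ℝ) / 2) := by
    rw [show 2 * Real.pi * (r ^ 2 * τ) = r ^ 2 * (2 * Real.pi * τ) by ring,
      Real.mul_rpow hr2.le (by positivity), ← Real.rpow_natCast r 2, ← Real.rpow_mul hr.le]
    congr 2
    push_cast
    ring
  have e2 : r ^ (2 - (d : ℝ)) = r ^ 2 * r ^ (-(d : ℝ)) := by
    rw [sub_eq_add_neg, Real.rpow_add hr]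
    norm_num
  have e3 : -r ^ 2 / (2 * (r ^ 2 * τ)) = -1 ^ 2 / (2 * τ) := by field_simp
  simp only [radialKernel]
  rw [e1, e2, e3]
  ring

theorem tendsto_resolvent_of_three_le {d : ℕ} (hd : 3 ≤ d) {r : ℝ} (hr : 0 < r) :
    Tendsto (resolvent d r) (𝓝[>] 0)
      (𝓝 ((∫ τ in Ioi (0 : ℝ), radialKernel d 1 τ) * r ^ (2 - (d : ℝ)))) := by
  rw [← integral_radialKernel d hr]
  have hev : ∀ᶠ p in 𝓝[>] (0 : ℝ), 0 < p := eventually_mem_nhdsWithin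
  refine tendsto_integral_filter_of_dominated_convergence _ (Eventually.of_forall fun p =>
    (Measurable.mul (by fun_prop) (measurable_radialKernel d r)).aestronglyMeasurable) ?_
    (integrableOn_radialKernel hd hr.ne') ?_
  · filter_upwards [hev] with p hp
    filter_upwards [ae_restrict_mem measurableSet_Ioi] with τ hτ
    have h0 := radialKernel_pos d r hτ
    rw [Real.norm_of_nonneg (by positivity)]
    exact mul_le_of_le_one_left h0.le (Real.exp_le_one_iff.2 (by nlinarith [mem_Ioi.1 hτ]))
  · refine Eventually.of_forall fun τ => ?_
    have hc : Continuous fun p : ℝ => Real.exp (-p * τ) * radialKernel d r τ := by fun_prop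
    have h0 := (hc.tendsto 0).mono_left (nhdsWithin_le_nhds (s := Ioi 0))
    simpa using h0

/-! ### Asymptotics of the Cesàro means -/

/-- Dilations shift `log (1/z)` by a constant, which is negligible. -/
theorem tendsto_log_one_div_mul_div (n : ℕ) :
    Tendsto (fun z : ℝ => Real.log (1 / (((n : ℝ) + 1) * z)) / Real.log (1 / z))
      (𝓝[>] 0) (𝓝 1) := by
  have hn : (0 : ℝ) < (n : ℝ) + 1 := by positivity
  have hL := tendsto_log_one_div_nhdsGT_zero
  have h : Tendsto (fun z : ℝ => 1 - Real.log ((n : ℝ) + 1) / Real.log (1 / z))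
      (𝓝[>] 0) (𝓝 1) := by
    simpa using (hL.const_div_atTop (Real.log ((n : ℝ) + 1))).const_sub 1
  refine h.congr' ?_
  filter_upwards [eventually_mem_nhdsWithin, hL.eventually_gt_atTop 0] with z hz hl
  have hz' : (0 : ℝ) < z := hz
  have e : Real.log (1 / (((n : ℝ) + 1) * z)) = Real.log (1 / z) - Real.log ((n : ℝ) + 1) := by
    rw [one_div, one_div, Real.log_inv, Real.log_inv, Real.log_mul hn.ne' hz'.ne']
    ring
  rw [e, sub_div, div_self hl.ne']

/-- If the ratio of two functions tends to a positive constant and one of them tends to infinity,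
then their logarithms are equivalent. -/
theorem tendsto_log_div_log {ι : Type*} {l : Filter ι} {u v : ι → ℝ} {c : ℝ} (hc : 0 < c)
    (hv : Tendsto v l atTop) (h : Tendsto (fun i => u i / v i) l (𝓝 c)) :
    Tendsto (fun i => Real.log (u i) / Real.log (v i)) l (𝓝 1) := by
  have hlv := Real.tendsto_log_atTop.comp hv
  have h1 : Tendsto (fun i => Real.log (u i / v i) / Real.log (v i)) l (𝓝 0) :=
    (h.log hc.ne').div_atTop hlv
  have h2 : Tendsto (fun i => 1 + Real.log (u i / v i) / Real.log (v i)) l (𝓝 1) := by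
    simpa using h1.const_add 1
  refine h2.congr' ?_
  filter_upwards [hv.eventually_gt_atTop 0, hlv.eventually_gt_atTop 0, h.eventually_const_lt hc]
    with i hi hli hr
  simp only [Function.comp] at hli
  have hu : 0 < u i := (div_pos_iff_of_pos_right hi).1 hr
  rw [Real.log_div hu.ne' hi.ne']
  field_simp
  ring

/-- The hypothesis on `𝒦`, rewritten for the Laplace exponent `Φ(z) = z 𝒦(z)`. -/
theorem HasLevyMeasure.tendsto_laplaceExponent_mul_log (hσ : HasLevyMeasure S P σ) {μ₀ : ℝ}
    (hμ₀ : μ₀ ≠ 0) (h : levyTailLaplace σ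
      ~[𝓝[>] 0] (fun z : ℝ => z⁻¹ * (μ₀ * (Real.log (1 / z))⁻¹))) :
    Tendsto (fun z => laplaceExponent σ z * Real.log (1 / z)) (𝓝[>] 0) (𝓝 μ₀) := by
  have hσ0 : σ (Ioi 0) ≠ 0 := by simp [hσ.infinite_mass]
  have hev : ∀ᶠ z in 𝓝[>] (0 : ℝ), 0 < z ∧ 0 < Real.log (1 / z) :=
    eventually_mem_nhdsWithin.and (tendsto_log_one_div_nhdsGT_zero.eventually_gt_atTop 0)
  have hne : ∀ᶠ z in 𝓝[>] (0 : ℝ), z⁻¹ * (μ₀ * (Real.log (1 / z))⁻¹) ≠ 0 :=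
    hev.mono fun z hz => mul_ne_zero (inv_ne_zero hz.1.ne')
      (mul_ne_zero hμ₀ (inv_ne_zero hz.2.ne'))
  have h1 := ((isEquivalent_iff_tendsto_one hne).1 h).mul_const μ₀
  rw [one_mul] at h1
  refine h1.congr' ?_
  filter_upwards [hev] with z ⟨hz, hl⟩
  rw [Pi.div_apply, levyTailLaplace_eq hσ.lintegral_min_lt_top hσ0 hz]
  field_simp

theorem HasLevyMeasure.pos_of_isEquivalent (hσ : HasLevyMeasure S P σ) {μ₀ : ℝ}
    (hμ₀ : μ₀ ≠ 0) (h : levyTailLaplace σ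
      ~[𝓝[>] 0] (fun z : ℝ => z⁻¹ * (μ₀ * (Real.log (1 / z))⁻¹))) : 0 < μ₀ := by
  have hσ0 : σ (Ioi 0) ≠ 0 := by simp [hσ.infinite_mass]
  refine lt_of_le_of_ne (ge_of_tendsto (hσ.tendsto_laplaceExponent_mul_log hμ₀ h) ?_) hμ₀.symm
  filter_upwards [eventually_mem_nhdsWithin,
    tendsto_log_one_div_nhdsGT_zero.eventually_gt_atTop 0] with z hz hl
  exact (mul_pos (laplaceExponent_pos hσ.lintegral_min_lt_top hσ0 hz) hl).le

theorem HasLevyMeasure.tendsto_laplaceExponent (hσ : HasLevyMeasure S P σ) {μ₀ : ℝ}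
    (h : Tendsto (fun z => laplaceExponent σ z * Real.log (1 / z)) (𝓝[>] 0) (𝓝 μ₀)) :
    Tendsto (laplaceExponent σ) (𝓝[>] 0) (𝓝[>] 0) := by
  have hσ0 : σ (Ioi 0) ≠ 0 := by simp [hσ.infinite_mass]
  refine tendsto_nhdsWithin_iff.2 ⟨?_, ?_⟩
  · refine (h.div_atTop tendsto_log_one_div_nhdsGT_zero).congr' ?_
    filter_upwards [tendsto_log_one_div_nhdsGT_zero.eventually_gt_atTop 0] with z hl
    rw [mul_div_cancel_right₀ _ hl.ne']
  · filter_upwards [eventually_mem_nhdsWithin] with z hz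
    exact laplaceExponent_pos hσ.lintegral_min_lt_top hσ0 hz

theorem IsSubordinator.laplace_subordinatedKernel [IsProbabilityMeasure P]
    (hS : IsSubordinator S P) (hσ : HasLevyMeasure S P σ) {d : ℕ}
    {x : EuclideanSpace ℝ (Fin d)} (hx : d = 1 ∨ 0 < d ∧ x ≠ 0) {z : ℝ} (hz : 0 < z) :
    IntegrableOn (fun t => Real.exp (-z * t) * subordinatedKernel S P x t) (Ioi 0) ∧
      ∫ t in Ioi (0 : ℝ), Real.exp (-z * t) * subordinatedKernel S P x t
        = z⁻¹ * laplaceExponent σ z * resolvent d ‖x‖ (laplaceExponent σ z) :=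
  hS.laplace_subordinated hσ (measurable_radialKernel d ‖x‖)
    (fun _ hτ => (radialKernel_pos d ‖x‖ hτ).le)
    (fun _ hp => integrableOn_exp_mul_radialKernel
      (hx.imp_right fun h => ⟨h.1, norm_ne_zero_iff.2 h.2⟩) hp) hz

theorem IsSubordinator.cesaroMeanWellDefined [IsProbabilityMeasure P]
    (hS : IsSubordinator S P) (hσ : HasLevyMeasure S P σ) {d : ℕ}
    {x : EuclideanSpace ℝ (Fin d)} (hx : d = 1 ∨ 0 < d ∧ x ≠ 0) :
    CesaroMeanWellDefined S P x := by
  refine ⟨?_, fun t ht => ?_⟩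
  · exact (hS.ae_integrableOn_mul_inverseDensity hσ (measurable_radialKernel d ‖x‖)
      (fun _ hτ => (radialKernel_pos d ‖x‖ hτ).le)
      (fun _ hp => integrableOn_exp_mul_radialKernel
        (hx.imp_right fun h => ⟨h.1, norm_ne_zero_iff.2 h.2⟩) hp)).mono
      fun s hs => ⟨hs.1, hs.2.1⟩
  · have h := ((hS.laplace_subordinatedKernel hσ hx one_pos).1.mono_set
      (Ioc_subset_Ioi_self : Ioc 0 t ⊆ Ioi 0)).continuousOn_mul_of_subset
      (g := fun s : ℝ => Real.exp s) (K := Icc 0 t) (by fun_prop) isCompact_Icc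
      measurableSet_Ioc Ioc_subset_Icc_self
    refine h.congr_fun (fun s _ => ?_) measurableSet_Ioc
    simp only
    rw [← mul_assoc, ← Real.exp_add]
    simp

theorem IsSubordinator.cesaroMean_subordinatedKernel [IsProbabilityMeasure P]
    (hS : IsSubordinator S P) (hσ : HasLevyMeasure S P σ) {d : ℕ}
    {x : EuclideanSpace ℝ (Fin d)} (hx : d = 1 ∨ 0 < d ∧ x ≠ 0) {ℓ : ℝ → ℝ}
    (hpos : ∀ᶠ z in 𝓝[>] (0 : ℝ), 0 < ℓ z)
    (hslow : ∀ n : ℕ, Tendsto (fun z => ℓ (((n : ℝ) + 1) * z) / ℓ z) (𝓝[>] 0) (𝓝 1))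
    (hlap : Tendsto (fun z => laplaceExponent σ z * resolvent d ‖x‖ (laplaceExponent σ z) / ℓ z)
      (𝓝[>] 0) (𝓝 1)) :
    cesaroMean (subordinatedKernel S P x) ~[atTop] fun t => ℓ t⁻¹ := by
  refine cesaroMean_isEquivalent (fun t => ?_)
    (fun z hz => (hS.laplace_subordinatedKernel hσ hx hz).1) hpos hslow (hlap.congr' ?_)
  · exact setIntegral_nonneg measurableSet_Ioi fun τ hτ =>
      mul_nonneg (radialKernel_pos d ‖x‖ hτ).le (inverseDensity_nonneg S P t τ)
  · filter_upwards [eventually_mem_nhdsWithin] with z hz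
    have hz' : (0 : ℝ) < z := hz
    rw [(hS.laplace_subordinatedKernel hσ hx hz').2]
    field_simp

theorem IsSubordinator.cesaroMean_dim_one [IsProbabilityMeasure P]
    (hS : IsSubordinator S P) (hσ : HasLevyMeasure S P σ) {μ₀ : ℝ} (hμ₀ : 0 < μ₀)
    (h : Tendsto (fun z => laplaceExponent σ z * Real.log (1 / z)) (𝓝[>] 0) (𝓝 μ₀))
    (x : EuclideanSpace ℝ (Fin 1)) :
    cesaroMean (subordinatedKernel S P x) ~[atTop] fun t : ℝ =>
      resolventConstOne * μ₀ ^ (1 / 2 : ℝ) * (Real.log t) ^ (-(1 / 2) : ℝ) *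
        Real.exp (-(√(2 * μ₀) * ‖x‖ * (Real.log t) ^ (-(1 / 2) : ℝ))) := by
  have hσ0 : σ (Ioi 0) ≠ 0 := by simp [hσ.infinite_mass]
  have hc := resolventConstOne_pos
  set C := resolventConstOne * μ₀ ^ (1 / 2 : ℝ) with hC
  have hC0 : 0 < C := by positivity
  have hL := tendsto_log_one_div_nhdsGT_zero
  have hLpos := hL.eventually_gt_atTop 0
  have hΦ := hσ.tendsto_laplaceExponent h
  have key := hS.cesaroMean_subordinatedKernel hσ (x := x) (Or.inl rfl)
    (ℓ := fun z => C * (Real.log (1 / z)) ^ (-(1 / 2) : ℝ))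
    (hLpos.mono fun z hz => by positivity) (fun n => ?_) ?_
  · -- The exponential factor tends to `1`.
    have hexp : Tendsto (fun t : ℝ => Real.exp (-(√(2 * μ₀) * ‖x‖ *
        (Real.log t) ^ (-(1 / 2) : ℝ)))) atTop (𝓝 1) := by
      have h1 := ((tendsto_rpow_neg_atTop (y := 1 / 2) (by norm_num)).comp
        Real.tendsto_log_atTop).const_mul (√(2 * μ₀) * ‖x‖)
      have h2 := (Real.continuous_exp.tendsto _).comp h1.neg
      simpa [Function.comp_def] using h2
    have hone : (fun t : ℝ => Real.exp (-(√(2 * μ₀) * ‖x‖ *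
        (Real.log t) ^ (-(1 / 2) : ℝ)))) ~[atTop] fun _ => (1 : ℝ) :=
      (isEquivalent_const_iff_tendsto one_ne_zero).2 hexp
    have h3 := (IsEquivalent.refl (u := fun t : ℝ =>
      C * (Real.log t) ^ (-(1 / 2) : ℝ)) (l := atTop)).mul hone
    refine IsEquivalent.trans ?_ h3.symm
    simpa [Pi.mul_def] using key
  · have h1 := (tendsto_log_one_div_mul_div n).rpow_const (p := -(1 / 2))
      (Or.inl one_ne_zero)
    rw [Real.one_rpow] at h1
    have hsc : ∀ᶠ z in 𝓝[>] (0 : ℝ),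
        0 < Real.log (1 / (((n : ℝ) + 1) * z)) / Real.log (1 / z) :=
      (tendsto_log_one_div_mul_div n).eventually_const_lt one_pos
    refine h1.congr' ?_
    filter_upwards [hLpos, hsc] with z hl hs
    have hl' := (div_pos_iff_of_pos_right hl).1 hs
    rw [Real.div_rpow hl'.le hl.le, mul_div_mul_left _ _ hC0.ne']
  · have h1 := (h.rpow_const (p := 1 / 2) (Or.inl hμ₀.ne')).mul
      ((tendsto_sqrt_mul_resolvent_one ‖x‖).comp hΦ)
    have h2 := h1.div_const C
    rw [mul_comm (μ₀ ^ (1 / 2 : ℝ)), ← hC, div_self hC0.ne'] at h2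
    refine h2.congr' ?_
    filter_upwards [eventually_mem_nhdsWithin, hLpos] with z hz hl
    have hp := laplaceExponent_pos hσ.lintegral_min_lt_top hσ0 hz
    have e1 : laplaceExponent σ z ^ (1 / 2 : ℝ) * laplaceExponent σ z ^ (1 / 2 : ℝ)
        = laplaceExponent σ z := by
      rw [← Real.rpow_add hp]; norm_num
    simp only [Function.comp]
    rw [Real.mul_rpow hp.le hl.le, Real.rpow_neg hl.le]
    nth_rewrite 4 [← e1]
    field_simp

theorem IsSubordinator.cesaroMean_dim_two [IsProbabilityMeasure P]
    (hS : IsSubordinator S P) (hσ : HasLevyMeasure S P σ) {μ₀ : ℝ} (hμ₀ : 0 < μ₀)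
    (h : Tendsto (fun z => laplaceExponent σ z * Real.log (1 / z)) (𝓝[>] 0) (𝓝 μ₀))
    {x : EuclideanSpace ℝ (Fin 2)} (hx : x ≠ 0) :
    cesaroMean (subordinatedKernel S P x) ~[atTop] fun t : ℝ =>
      -(μ₀ / Real.pi) * (Real.log t)⁻¹ *
        Real.log (√(2 * μ₀) * ‖x‖ * (Real.log t) ^ (-(1 / 2) : ℝ)) := by
  have hπ := Real.pi_pos
  have hσ0 : σ (Ioi 0) ≠ 0 := by simp [hσ.infinite_mass]
  have hr : 0 < ‖x‖ := norm_pos_iff.2 hx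
  set C := μ₀ * (2 * Real.pi)⁻¹ with hC
  have hC0 : 0 < C := by positivity
  have hL := tendsto_log_one_div_nhdsGT_zero
  have hLpos := hL.eventually_gt_atTop 0
  have hLL := Real.tendsto_log_atTop.comp hL
  have hLLpos : ∀ᶠ z in 𝓝[>] (0 : ℝ), 0 < Real.log (Real.log (1 / z)) :=
    hLL.eventually_gt_atTop 0
  have hΦ := hσ.tendsto_laplaceExponent h
  have key := hS.cesaroMean_subordinatedKernel hσ (x := x) (Or.inr ⟨two_pos, hx⟩)
    (ℓ := fun z => C * ((Real.log (1 / z))⁻¹ * Real.log (Real.log (1 / z))))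
    ?_ (fun n => ?_) ?_
  · -- The logarithm in the statement is equivalent to `-(1/2) log (log t)`.
    set A := √(2 * μ₀) * ‖x‖ with hA
    have hA0 : 0 < A := by positivity
    have hll : Tendsto (fun t : ℝ => Real.log (Real.log t)) atTop atTop :=
      Real.tendsto_log_atTop.comp Real.tendsto_log_atTop
    have hlim : Tendsto (fun t : ℝ => -2 * (Real.log A / Real.log (Real.log t)) + 1)
        atTop (𝓝 1) := by
      simpa using ((hll.const_div_atTop (Real.log A)).const_mul (-2)).add_const 1
    have hev : ∀ᶠ t : ℝ in atTop, 0 < Real.log t ∧ 0 < Real.log (Real.log t) :=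
      (Real.tendsto_log_atTop.eventually_gt_atTop 0).and (hll.eventually_gt_atTop 0)
    have hne : ∀ᶠ t : ℝ in atTop, C * ((Real.log (1 / t⁻¹))⁻¹
        * Real.log (Real.log (1 / t⁻¹))) ≠ 0 := by
      filter_upwards [hev] with t ⟨h1, h2⟩
      rw [one_div, inv_inv]
      positivity
    refine key.trans (IsEquivalent.symm ((isEquivalent_iff_tendsto_one hne).2
      (hlim.congr' ?_)))
    filter_upwards [hev] with t ⟨h1, h2⟩
    rw [Pi.div_apply, one_div t⁻¹, inv_inv, Real.log_mul hA0.ne' (Real.rpow_pos_of_pos h1 _).ne',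
      Real.log_rpow h1, hC]
    field_simp
    ring
  · filter_upwards [hLpos, hLLpos] with z h1 h2
    positivity
  · have h1 := (tendsto_log_one_div_mul_div n).inv₀ one_ne_zero
    have h2 := tendsto_log_div_log one_pos hL (tendsto_log_one_div_mul_div n)
    have h3 := h1.mul h2
    rw [inv_one, one_mul] at h3
    refine h3.congr' ?_
    filter_upwards [hLpos, hLLpos] with z hl hll
    field_simp
  · -- `log (1/Φ(z))` is equivalent to `log (log (1/z))`.
    have h0 : Tendsto (fun z => 1 / laplaceExponent σ z / Real.log (1 / z)) (𝓝[>] 0)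
        (𝓝 μ₀⁻¹) :=
      (h.inv₀ hμ₀.ne').congr fun z => by rw [div_div, one_div (_ * _)]
    have h1 := (h.mul ((tendsto_resolvent_two_div_log hr.ne').comp hΦ)).mul
      (tendsto_log_div_log (inv_pos.2 hμ₀) hL h0)
    have h2 := h1.div_const C
    rw [mul_one, ← hC, div_self hC0.ne'] at h2
    have hlogΦ := (tendsto_log_one_div_nhdsGT_zero.comp hΦ).eventually_gt_atTop 0
    refine h2.congr' ?_
    filter_upwards [hLpos, hLLpos, hlogΦ] with z hl hll hlp
    simp only [Function.comp] at hlp ⊢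
    field_simp

theorem integral_radialKernel_one_pos {d : ℕ} (hd : 3 ≤ d) :
    0 < ∫ τ in Ioi (0 : ℝ), radialKernel d 1 τ :=
  setIntegral_Ioi_pos (integrableOn_radialKernel hd one_ne_zero) fun _ => radialKernel_pos d 1

theorem IsSubordinator.cesaroMean_three_le [IsProbabilityMeasure P]
    (hS : IsSubordinator S P) (hσ : HasLevyMeasure S P σ) {μ₀ : ℝ} (hμ₀ : 0 < μ₀)
    (h : Tendsto (fun z => laplaceExponent σ z * Real.log (1 / z)) (𝓝[>] 0) (𝓝 μ₀))
    {d : ℕ} (hd : 3 ≤ d) {x : EuclideanSpace ℝ (Fin d)} (hx : x ≠ 0) :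
    cesaroMean (subordinatedKernel S P x) ~[atTop] fun t : ℝ =>
      (μ₀ * ∫ τ in Ioi (0 : ℝ), radialKernel d 1 τ) * ‖x‖ ^ (2 - (d : ℝ))
        * (Real.log t)⁻¹ := by
  have hr : 0 < ‖x‖ := norm_pos_iff.2 hx
  have hI := integral_radialKernel_one_pos hd
  set C := (μ₀ * ∫ τ in Ioi (0 : ℝ), radialKernel d 1 τ) * ‖x‖ ^ (2 - (d : ℝ)) with hC
  have hC0 : 0 < C := by positivity
  have hL := tendsto_log_one_div_nhdsGT_zero
  have hLpos := hL.eventually_gt_atTop 0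
  have key := hS.cesaroMean_subordinatedKernel hσ (x := x) (Or.inr ⟨by lia, hx⟩)
    (ℓ := fun z => C * (Real.log (1 / z))⁻¹) (hLpos.mono fun z hz => by positivity)
    (fun n => ?_) ?_
  · simpa using key
  · have h1 := (tendsto_log_one_div_mul_div n).inv₀ one_ne_zero
    rw [inv_one] at h1
    refine h1.congr' ?_
    filter_upwards [hLpos] with z hl
    field_simp
  · have h1 := (h.mul ((tendsto_resolvent_of_three_le hd hr).comp
      (hσ.tendsto_laplaceExponent h))).div_const C
    rw [← mul_assoc, ← hC, div_self hC0.ne'] at h1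
    refine h1.congr' ?_
    filter_upwards [hLpos] with z hl
    simp only [Function.comp]
    field_simp

end SubordinatedHeat

theorem mainTheorem2 (d : ℕ) (μ₀ : ℝ) (hμ₀ : μ₀ ≠ 0) :
    ∃ C : ℝ, C ≠ 0 ∧
      ∀ (Ω : Type*) [MeasurableSpace Ω] (P : Measure Ω) [IsProbabilityMeasure P]
        (S : ℝ≥0 → Ω → ℝ) (σ : Measure ℝ),
        SubordinatedHeat.IsSubordinator S P →
        SubordinatedHeat.HasLevyMeasure S P σ →
        SubordinatedHeat.levyTailLaplace σ
          ~[𝓝[>] 0] (fun z : ℝ => z⁻¹ * (μ₀ * (Real.log (1 / z))⁻¹)) →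
        ∀ x : EuclideanSpace ℝ (Fin d), (d = 1 ∨ x ≠ 0) →
          SubordinatedHeat.CesaroMeanWellDefined S P x ∧
          (d = 1 →
            SubordinatedHeat.cesaroMean (SubordinatedHeat.subordinatedKernel S P x)
              ~[atTop] fun t : ℝ => C * (Real.log t) ^ (-(1 / 2) : ℝ) *
                Real.exp (-(√(2 * μ₀) * ‖x‖ * (Real.log t) ^ (-(1 / 2) : ℝ)))) ∧
          (d = 2 →
            SubordinatedHeat.cesaroMean (SubordinatedHeat.subordinatedKernel S P x)
              ~[atTop] fun t : ℝ => C * (Real.log t)⁻¹ *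
                Real.log (√(2 * μ₀) * ‖x‖ * (Real.log t) ^ (-(1 / 2) : ℝ))) ∧
          (3 ≤ d →
            SubordinatedHeat.cesaroMean (SubordinatedHeat.subordinatedKernel S P x)
              ~[atTop] fun t : ℝ => C * ‖x‖ ^ (2 - (d : ℝ)) * (Real.log t)⁻¹) := by
  -- The constant in terms of `d` and `μ₀`. If `μ₀ < 0` the hypothesis on `𝒦 ≥ 0` cannot hold, and
  -- if `d = 0` there is no admissible `x`; any nonzero value does in these cases.
  open SubordinatedHeat in
  obtain ⟨C, hC0, h1, h2, h3⟩ : ∃ C : ℝ, C ≠ 0 ∧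
      (0 < μ₀ → d = 1 → C = resolventConstOne * μ₀ ^ (1 / 2 : ℝ)) ∧
      (0 < μ₀ → d = 2 → C = -(μ₀ / Real.pi)) ∧
      (0 < μ₀ → 3 ≤ d → C = μ₀ * ∫ τ in Set.Ioi (0 : ℝ), radialKernel d 1 τ) := by
    by_cases hpos : 0 < μ₀
    · rcases (by lia : d = 0 ∨ d = 1 ∨ d = 2 ∨ 3 ≤ d) with hd | hd | hd | hd
      · exact ⟨1, one_ne_zero, fun _ _ => by lia, fun _ _ => by lia, fun _ _ => by lia⟩
      · have := resolventConstOne_pos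
        exact ⟨_, by positivity, fun _ _ => rfl, fun _ _ => by lia, fun _ _ => by lia⟩
      · have := Real.pi_pos
        exact ⟨_, neg_ne_zero.2 (by positivity), fun _ _ => by lia, fun _ _ => rfl,
          fun _ _ => by lia⟩
      · have := integral_radialKernel_one_pos hd
        exact ⟨_, by positivity, fun _ _ => by lia, fun _ _ => by lia, fun _ _ => rfl⟩
    · exact ⟨1, one_ne_zero, fun h => absurd h hpos, fun h => absurd h hpos,
        fun h => absurd h hpos⟩
  refine ⟨C, hC0, fun Ω _ P _ S σ hS hσ hK x hx => ?_⟩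
  have hpos := hσ.pos_of_isEquivalent hμ₀ hK
  have hlim := hσ.tendsto_laplaceExponent_mul_log hμ₀ hK
  have hx' : d = 1 ∨ 0 < d ∧ x ≠ 0 := by
    refine hx.imp_right fun h => ⟨Nat.pos_of_ne_zero fun hd => h ?_, h⟩
    subst hd
    exact Subsingleton.elim _ _
  refine ⟨hS.cesaroMeanWellDefined hσ hx', fun hd => ?_, fun hd => ?_, fun hd => ?_⟩
  · rw [h1 hpos hd]
    subst hd
    exact hS.cesaroMean_dim_one hσ hpos hlim x
  · rw [h2 hpos hd]
    subst hd
    exact hS.cesaroMean_dim_two hσ hpos hlim (hx.resolve_left (by lia))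
  · rw [h3 hpos hd]
    exact hS.cesaroMean_three_le hσ hpos hlim hd (hx.resolve_left (by lia))
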